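/- Let $D$ be a strongly self-absorbing $C^*$-algebra, i.e. a separable unital $C^*$-algebra for which there are a $*$-isomorphism $\psi\colon D\to D\otimes D$ and a norm continuous path of unitaries $u\colon[0,1)\to U(D\otimes D)$ with $\lim_{t\to1}\|\psi(d)-u_t(d\otimes1)u_t^*\|=0$ for all $d\in D$. Here $\otimes$ is the spatial (minimal) tensor product. Let $\mathbb K$ be the compact operators on $\ell^2(\mathbb N)$, let $G=\mathrm{Aut}(D\otimes\mathbb K)$ and $G_2=\mathrm{Aut}((D\otimes\mathbb K)^{\otimes2})$ with the topology of pointwise norm convergence, let $\kappa\colon G\times G\to G_2$, $\kappa(\alpha,\beta)=\alpha\otimes\beta$, and let $EG\to BG$ be a universal principal $G$-bundle (a locally trivial principal bundle with weakly contractible total space). For principal $G$-bundles $P,P'$ over $X$ put $P\otimes P'=(P\times_XP')\times_\kappa G_2$. Let $CW_D$ be the following category. Its objects are tuples $(X,f,f^-,\tau)$ with $X$ a finite CW complex, $f,f^-\colon X\to BG$ continuous, and $\tau\colon P_f\otimes P_f^-\to X\times G_2$ a trivialization, where $P_f=f^*EG$ and $P_f^-=(f^-)^*EG$. A morphism $(X,f,f^-,\tau)\to(X',f',f'^-,\tau')$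 is a tuple $(\varphi,\hat\varphi,\hat\varphi^-,\rho)$ with $\varphi\colon X\to X'$ continuous, $\hat\varphi\colon P_f\to P_{f'}$ and $\hat\varphi^-\colon P_f^-\to P_{f'}^-$ maps of principal bundles covering $\varphi$, and $\rho\colon X\to G_2$ continuous, such that $\tau'\circ(\hat\varphi\otimes\hat\varphi^-)=\lambda_\rho\circ\tau$, where $\lambda_\rho(x,a)=(\varphi(x),\rho(x)a)$. Two morphisms are homotopic if they are joined by a family of morphisms $(\varphi_t,\hat\varphi_t,\hat\varphi^-_t,\rho_t)_{t\in[0,1]}$ all of whose components are jointly continuous in $t$ and the respective argument. A subcomplex of $X$ becomes an object by restriction of all data. Let $h_*,h'_*\colon CW_D\to\mathrm{GrAb}$ be functors to $\mathbb Z$-graded abelian groups such that for each of them (written for $h$): (i) homotopic morphisms induce the same map; (ii) for every object $X$ and all subcomplexes $A,B\subset X$ with $X=A\cup B$ there are boundary maps $\partial\colon h_k(X)\to h_{k-1}(A\cap B)$, natural for morphisms $X\to X'$ that map $A$ into $A'$ and $B$ into $B'$, such that the sequence $$\cdots\to h_k(A\cap B)\to h_k(A)\oplus h_k(B)\to h_k(X)\xrightarrow{\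 \partial\ }h_{k-1}(A\cap B)\to\cdots$$ is exact, where the other maps are $x\mapsto(x|_A,x|_B)$ and $(a,b)\mapsto a|_X-b|_X$, all induced by the inclusions. Let $\eta\colon h_*\to h'_*$ be a natural transformation that commutes with the boundary maps $\partial$. Suppose that $\eta_X$ is an isomorphism for every object $X$ whose underlying space is a single point, and also for every object whose underlying space is empty (which is automatic if $h_*(\emptyset)=0=h'_*(\emptyset)$). Then $\eta_X$ is an isomorphism for every object $X$ of $CW_D$. -/

import Mathlib

universe u v w

open CategoryTheory Topology
open MulOpposite (op)
open scoped ENNReal TensorProduct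

namespace HigherTwist

noncomputable section


/-! ### The spatial tensor product of C*-algebras -/

/-- The Hilbert space `ℓ²(ι)`. -/
abbrev EllTwo (ι : Type u) : Type u := lp (fun _ : ι => ℂ) 2

/-- The Hilbert space tensor product. -/
abbrev HilbertTensor (H : Type u) (K : Type v) [NormedAddCommGroup H] [InnerProductSpace ℂ H]
    [NormedAddCommGroup K] [InnerProductSpace ℂ K] : Type (max u v) :=
  UniformSpace.Completion (H ⊗[ℂ] K)

section OperatorTensor

variable {H : Type u} {K : Type v} [NormedAddCommGroup H] [InnerProductSpace ℂ H]
  [NormedAddCommGroup K] [InnerProductSpace ℂ K]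

/-- The bounded operator `S ⊗ T` on the Hilbert space tensor product, which is determined by
`(S ⊗ T) (x ⊗ y) = S x ⊗ T y`. -/
def opTensor (S : H →L[ℂ] H) (T : K →L[ℂ] K) : HilbertTensor H K →L[ℂ] HilbertTensor H K :=
  ((UniformSpace.Completion.toComplL (𝕜 := ℂ) (E := H ⊗[ℂ] K)).comp
    (TensorProduct.mapL S T)).extend (UniformSpace.Completion.toComplL (𝕜 := ℂ) (E := H ⊗[ℂ] K))

theorem opTensor_coe (S : H →L[ℂ] H) (T : K →L[ℂ] K) (z : H ⊗[ℂ] K) :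
    opTensor S T (z : HilbertTensor H K) = ((TensorProduct.mapL S T z : H ⊗[ℂ] K) :
      HilbertTensor H K) :=
  ContinuousLinearMap.extend_eq _
    (UniformSpace.Completion.denseRange_coe (α := H ⊗[ℂ] K))
    (UniformSpace.Completion.isUniformInducing_coe (H ⊗[ℂ] K)) z

theorem norm_opTensor_le (S : H →L[ℂ] H) (T : K →L[ℂ] K) : ‖opTensor S T‖ ≤ ‖S‖ * ‖T‖ := by
  refine ContinuousLinearMap.opNorm_le_bound _ (by positivity) fun z => ?_
  induction z using UniformSpace.Completion.induction_on with
  | hp => exact isClosed_le (by fun_prop) (by fun_prop)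
  | ih z =>
    rw [opTensor_coe, UniformSpace.Completion.norm_coe, UniformSpace.Completion.norm_coe]
    exact (ContinuousLinearMap.le_opNorm _ z).trans
      (mul_le_mul_of_nonneg_right (TensorProduct.norm_mapL_le S T) (norm_nonneg z))

end OperatorTensor

section BoundedFamilies

/-- The C*-algebra `ℓ^∞(I, C)` of bounded families in a C*-algebra `C`. -/
def BddFamily (I : Type u) (C : Type v) [NonUnitalCStarAlgebra C] : Type (max u v) :=
  lp (fun _ : I => C) ∞

variable {I : Type u} {C : Type v} [NonUnitalCStarAlgebra C]

instance : NonUnitalCStarAlgebra (BddFamily I C) :=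
  inferInstanceAs (NonUnitalCStarAlgebra (lp (fun _ : I => C) ∞))

/-- The member of a bounded family with a given index. -/
def BddFamily.eval (x : BddFamily I C) (i : I) : C := x.1 i

theorem BddFamily.ext {x y : BddFamily I C} (h : ∀ i, x.eval i = y.eval i) : x = y :=
  Subtype.ext (funext h)

/-- The bounded family with given members. -/
def BddFamily.mk (x : I → C) (M : ℝ) (hM : ∀ i, ‖x i‖ ≤ M) : BddFamily I C :=
  ⟨x, memℓp_infty ⟨M, by rintro _ ⟨i, rfl⟩; exact hM i⟩⟩

/-- Reindexing of bounded families along a self-map of the index set. -/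
def reindex (s : I → I) : BddFamily I C →⋆ₙₐ[ℂ] BddFamily I C where
  toFun x := ⟨fun i => x.eval (s i), memℓp_infty (by
    obtain ⟨M, hM⟩ := memℓp_infty_iff.mp (lp.memℓp x)
    exact ⟨M, by rintro _ ⟨i, rfl⟩; exact hM ⟨s i, rfl⟩⟩)⟩
  map_smul' _ _ := rfl
  map_zero' := rfl
  map_add' _ _ := rfl
  map_mul' _ _ := rfl
  map_star' _ := rfl

theorem reindex_eval (s : I → I) (x : BddFamily I C) (i : I) :
    (reindex s x).eval i = x.eval (s i) := rfl

end BoundedFamilies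

section Generated

variable {C : Type u} [NonUnitalCStarAlgebra C]

/-- The C*-subalgebra generated by a set. -/
def generatedBy (S : Set C) : NonUnitalStarSubalgebra ℂ C :=
  (NonUnitalStarAlgebra.adjoin ℂ S).topologicalClosure

theorem isClosed_generatedBy (S : Set C) : IsClosed (generatedBy S : Set C) :=
  NonUnitalStarSubalgebra.isClosed_topologicalClosure _

theorem subset_generatedBy (S : Set C) : S ⊆ generatedBy S :=
  (NonUnitalStarAlgebra.subset_adjoin ℂ S).trans
    (NonUnitalStarSubalgebra.le_topologicalClosure _)

theorem map_mem_generatedBy {S : Set C} (φ : C →⋆ₙₐ[ℂ] C) (hφ : ∀ x ∈ S, φ x ∈ S) {x : C}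
    (hx : x ∈ generatedBy S) : φ x ∈ generatedBy S := by
  have hc : Continuous φ := AddMonoidHomClass.continuous_of_bound φ 1 fun x => by
    rw [one_mul]
    exact NonUnitalStarAlgHom.norm_apply_le φ x
  have key : generatedBy S ≤ (generatedBy S).comap φ := by
    refine NonUnitalStarSubalgebra.topologicalClosure_minimal _ ?_ ?_
    · rw [NonUnitalStarAlgebra.adjoin_le_iff]
      exact fun x hx => subset_generatedBy S (hφ x hx)
    · exact (isClosed_generatedBy S).preimage hc
  exact key hx

end Generated

section SpatialTensor

/-- The representations of `A` on the Hilbert space `ℓ²(A)`. Every cyclic representation of `A`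
is a direct summand of one of these, as its Hilbert space has dimension at most `#A`; so the
direct sum of all of them is a faithful representation of `A`. -/
abbrev Rep (A : Type u) [NonUnitalCStarAlgebra A] : Type u :=
  A →⋆ₙₐ[ℂ] (EllTwo A →L[ℂ] EllTwo A)

variable (A : Type u) (B : Type v) [NonUnitalCStarAlgebra A] [NonUnitalCStarAlgebra B]

/-- The C*-algebra of block diagonal operators on `⨁ ℓ²(A) ⊗ ℓ²(B)`, with one block for each pair
of a representation of `A` and a representation of `B`. -/
abbrev Blocks : Type (max u v) :=
  BddFamily (Rep A × Rep B)
    (HilbertTensor (EllTwo A) (EllTwo B) →L[ℂ] HilbertTensor (EllTwo A) (EllTwo B))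

variable {A B}

/-- The elementary tensor `a ⊗ b`, which acts by `π a ⊗ σ b` on the block of `(π, σ)`. -/
def blockTmul (a : A) (b : B) : Blocks A B :=
  .mk (fun i => opTensor (i.1 a) (i.2 b)) (‖a‖ * ‖b‖) fun i =>
    (norm_opTensor_le _ _).trans (mul_le_mul (NonUnitalStarAlgHom.norm_apply_le i.1 a)
      (NonUnitalStarAlgHom.norm_apply_le i.2 b) (norm_nonneg _) (norm_nonneg _))

variable (A B)

/-- The spatial (minimal) tensor product of C*-algebras, as a C*-subalgebra of `Blocks A B`. -/
def spatialTensor : NonUnitalStarSubalgebra ℂ (Blocks A B) :=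
  generatedBy (Set.range fun q : A × B => blockTmul q.1 q.2)

/-- The spatial (minimal) tensor product `A ⊗ B` of C*-algebras. -/
def SpatialTensor : Type (max u v) := spatialTensor A B

instance : NonUnitalCStarAlgebra (SpatialTensor A B) :=
  NonUnitalStarSubalgebra.nonUnitalCStarAlgebra (spatialTensor A B)
    (h_closed := isClosed_generatedBy _)

variable {A B}

/-- The elementary tensor `a ⊗ b`. -/
def tmul (a : A) (b : B) : SpatialTensor A B :=
  ⟨blockTmul a b, subset_generatedBy _ ⟨(a, b), rfl⟩⟩

/-- Precomposition of the representations with automorphisms of the algebras. -/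
def repShift (α : A ≃⋆ₐ[ℂ] A) (β : B ≃⋆ₐ[ℂ] B) (i : Rep A × Rep B) : Rep A × Rep B :=
  (i.1.comp (α : A →⋆ₙₐ[ℂ] A), i.2.comp (β : B →⋆ₙₐ[ℂ] B))

theorem reindex_blockTmul (α : A ≃⋆ₐ[ℂ] A) (β : B ≃⋆ₐ[ℂ] B) (a : A) (b : B) :
    reindex (repShift α β) (blockTmul a b) = blockTmul (α a) (β b) := rfl

theorem reindex_mem (α : A ≃⋆ₐ[ℂ] A) (β : B ≃⋆ₐ[ℂ] B) {x : Blocks A B}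
    (hx : x ∈ spatialTensor A B) : reindex (repShift α β) x ∈ spatialTensor A B := by
  refine map_mem_generatedBy (reindex (repShift α β)) ?_ hx
  rintro _ ⟨q, rfl⟩
  exact ⟨(α q.1, β q.2), rfl⟩

/-- The automorphism `α ⊗ β` of `A ⊗ B`. -/
def tensorAut (α : A ≃⋆ₐ[ℂ] A) (β : B ≃⋆ₐ[ℂ] B) : SpatialTensor A B ≃⋆ₐ[ℂ] SpatialTensor A B where
  toFun x := ⟨reindex (repShift α β) x.1, reindex_mem α β x.2⟩
  invFun x := ⟨reindex (repShift α.symm β.symm) x.1, reindex_mem α.symm β.symm x.2⟩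
  left_inv x := by
    refine Subtype.ext (BddFamily.ext fun i => ?_)
    change x.1.eval (repShift α β (repShift α.symm β.symm i)) = _
    congr 1
    ext <;> simp [repShift]
  right_inv x := by
    refine Subtype.ext (BddFamily.ext fun i => ?_)
    change x.1.eval (repShift α.symm β.symm (repShift α β i)) = _
    congr 1
    ext <;> simp [repShift]
  map_mul' _ _ := rfl
  map_add' _ _ := rfl
  map_star' _ := rfl
  map_smul' _ _ := rfl

theorem tensorAut_tmul (α : A ≃⋆ₐ[ℂ] A) (β : B ≃⋆ₐ[ℂ] B) (a : A) (b : B) :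
    tensorAut α β (tmul a b) = tmul (α a) (β b) := rfl

variable (A B) in
/-- The group homomorphism `κ : Aut A × Aut B → Aut (A ⊗ B)`, `(α, β) ↦ α ⊗ β`. -/
def tensorAutHom : (A ≃⋆ₐ[ℂ] A) × (B ≃⋆ₐ[ℂ] B) →* (SpatialTensor A B ≃⋆ₐ[ℂ] SpatialTensor A B) where
  toFun q := tensorAut q.1 q.2
  map_one' := rfl
  map_mul' _ _ := rfl

end SpatialTensor

/-! ### Automorphism groups -/

section AutomorphismGroup

variable {A : Type u} [NonUnitalCStarAlgebra A]

/-- The topology of pointwise norm convergence on the automorphism group of a C*-algebra. -/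
instance autTopology : TopologicalSpace (A ≃⋆ₐ[ℂ] A) :=
  TopologicalSpace.induced (fun α a => α a) Pi.topologicalSpace

theorem continuous_aut_iff {T : Type v} [TopologicalSpace T] {F : T → (A ≃⋆ₐ[ℂ] A)} :
    Continuous F ↔ ∀ a, Continuous fun t => F t a := by
  rw [continuous_induced_rng, continuous_pi_iff]
  rfl

theorem continuous_aut_apply (a : A) : Continuous fun α : A ≃⋆ₐ[ℂ] A => α a :=
  continuous_aut_iff.mp continuous_id a

theorem dist_aut (α : A ≃⋆ₐ[ℂ] A) (a b : A) : dist (α a) (α b) = dist a b := by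
  rw [dist_eq_norm, dist_eq_norm, ← map_sub,
    NonUnitalStarAlgHom.norm_map α α.injective]

instance : IsTopologicalGroup (A ≃⋆ₐ[ℂ] A) where
  continuous_mul := by
    rw [continuous_aut_iff]
    refine fun a => continuous_iff_continuousAt.mpr fun q => ?_
    rw [ContinuousAt, tendsto_iff_dist_tendsto_zero]
    have h1 : Filter.Tendsto (fun r : (A ≃⋆ₐ[ℂ] A) × (A ≃⋆ₐ[ℂ] A) =>
        dist (r.2 a) (q.2 a) + dist (r.1 (q.2 a)) (q.1 (q.2 a))) (𝓝 q) (𝓝 0) := by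
      have hc : Continuous fun r : (A ≃⋆ₐ[ℂ] A) × (A ≃⋆ₐ[ℂ] A) =>
          dist (r.2 a) (q.2 a) + dist (r.1 (q.2 a)) (q.1 (q.2 a)) :=
        (((continuous_aut_apply a).comp continuous_snd).dist continuous_const).add
          (((continuous_aut_apply (q.2 a)).comp continuous_fst).dist continuous_const)
      simpa using hc.tendsto q
    refine squeeze_zero (fun _ => dist_nonneg) (fun r => ?_) h1
    calc dist (r.1 (r.2 a)) (q.1 (q.2 a))
        ≤ dist (r.1 (r.2 a)) (r.1 (q.2 a)) + dist (r.1 (q.2 a)) (q.1 (q.2 a)) :=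
          dist_triangle _ _ _
      _ = _ := by rw [dist_aut]
  continuous_inv := by
    rw [continuous_aut_iff]
    refine fun a => continuous_iff_continuousAt.mpr fun q => ?_
    rw [ContinuousAt, tendsto_iff_dist_tendsto_zero]
    have hc : Continuous fun r : A ≃⋆ₐ[ℂ] A => dist (q (q⁻¹ a)) (r (q⁻¹ a)) :=
      continuous_const.dist (continuous_aut_apply _)
    have h1 := hc.tendsto q
    rw [dist_self] at h1
    refine h1.congr fun r => ?_
    rw [← dist_aut r (r⁻¹ a)]
    congr 1
    exact (q.apply_symm_apply a).trans (r.apply_symm_apply a).symm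

end AutomorphismGroup

/-! ### Compact operators and strongly self-absorbing algebras -/

section Compacts

theorem isCompactOperator_adjoint {H : Type u} [NormedAddCommGroup H] [InnerProductSpace ℂ H]
    [CompleteSpace H] {T : H →L[ℂ] H} (hT : IsCompactOperator T) :
    IsCompactOperator (ContinuousLinearMap.adjoint T) := by
  set S := ContinuousLinearMap.adjoint T with hS
  have hTS : IsCompactOperator (T ∘ S) := hT.comp_clm S
  have hTS' : IsCompactOperator (T.comp S) := hTS
  have h1 : TotallyBounded ((T.comp S) '' Metric.ball 0 1) :=
    ((hTS'.isCompact_closure_image_ball (𝕜₁ := ℂ) (𝕜₂ := ℂ) (f := (T.comp S).toLinearMap)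
      1).totallyBounded).subset subset_closure
  refine (isCompactOperator_iff_isCompact_closure_image_ball (S.toLinearMap) one_pos).mpr ?_
  refine TotallyBounded.isCompact_of_isClosed
    (TotallyBounded.closure (Metric.totallyBounded_iff.mpr fun ε hε => ?_)) isClosed_closure
  obtain ⟨t, ht, hfin, hcov⟩ := Metric.finite_approx_of_totallyBounded h1 (ε ^ 2 / 2) (by positivity)
  obtain ⟨s, hs, hsfin, rfl⟩ := Set.exists_subset_image_finite_and.mp ⟨t, ht, hfin, rfl⟩
  refine ⟨S '' s, hsfin.image _, ?_⟩
  rintro _ ⟨x, hx, rfl⟩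
  have hx' := hcov ⟨x, hx, rfl⟩
  simp only [Set.mem_iUnion, Set.mem_image, exists_prop, exists_exists_and_eq_and] at hx' ⊢
  obtain ⟨y, hy, hxy⟩ := hx'
  refine ⟨y, hy, ?_⟩
  rw [Metric.mem_ball, dist_eq_norm] at hxy ⊢
  change ‖S x - S y‖ < ε
  rw [← map_sub] at hxy ⊢
  have hn : ‖x - y‖ ≤ 2 := by
    have h2 := norm_sub_le x y
    have h3 := mem_ball_zero_iff.mp hx
    have h4 := mem_ball_zero_iff.mp (hs hy)
    linarith
  have h5 : ‖S (x - y)‖ ^ 2 ≤ ‖(T.comp S) (x - y)‖ * ‖x - y‖ := by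
    rw [← inner_self_eq_norm_sq (𝕜 := ℂ)]
    conv_lhs => rw [hS, ContinuousLinearMap.adjoint_inner_right]
    exact (RCLike.re_le_norm _).trans (norm_inner_le_norm _ _)
  have h6 : ‖S (x - y)‖ ^ 2 < ε ^ 2 := by
    nlinarith [norm_nonneg ((T.comp S) (x - y)), norm_nonneg (x - y)]
  exact lt_of_pow_lt_pow_left₀ 2 hε.le h6

/-- The compact operators on the Hilbert space `ℓ²(ℕ)`, as a *-subalgebra. -/
def compacts : NonUnitalStarSubalgebra ℂ (EllTwo ℕ →L[ℂ] EllTwo ℕ) where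
  carrier := {T | IsCompactOperator T}
  add_mem' hS hT := IsCompactOperator.add hS hT
  zero_mem' := isCompactOperator_zero
  smul_mem' c _ hT := IsCompactOperator.smul hT c
  mul_mem' {S _} _ hT := IsCompactOperator.clm_comp hT S
  star_mem' hT := isCompactOperator_adjoint hT

/-- The C*-algebra `𝕂` of compact operators on the Hilbert space `ℓ²(ℕ)`. -/
def Compacts : Type := compacts

instance : NonUnitalCStarAlgebra Compacts :=
  NonUnitalStarSubalgebra.nonUnitalCStarAlgebra compacts
    (h_closed := isClosed_setOfPred_isCompactOperator)

/-- The stabilization `D ⊗ 𝕂`. -/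
abbrev Stabilization (D : Type u) [NonUnitalCStarAlgebra D] : Type u := SpatialTensor D Compacts

/-- Strongly self-absorbing C*-algebras: `D` is separable and unital, and there are an isomorphism
`ψ : D ≅ D ⊗ D` and a norm continuous path `u` of unitaries of `D ⊗ D` (whose unit is `1 ⊗ 1`)
such that `ψ d` is the limit of `u_t (d ⊗ 1) u_t^*` as `t → 1`, for every `d`. -/
def IsStronglySelfAbsorbing (D : Type u) [CStarAlgebra D] : Prop :=
  TopologicalSpace.SeparableSpace D ∧
  ∃ (ψ : D ≃⋆ₐ[ℂ] SpatialTensor D D) (u : ℝ → SpatialTensor D D),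
    ContinuousOn u (Set.Ico 0 1) ∧
    (∀ t ∈ Set.Ico (0 : ℝ) 1,
      star (u t) * u t = tmul (1 : D) (1 : D) ∧ u t * star (u t) = tmul (1 : D) (1 : D)) ∧
    ∀ d : D, Filter.Tendsto (fun t => ‖ψ d - u t * tmul d (1 : D) * star (u t)‖) (𝓝[<] 1) (𝓝 0)

end Compacts
/-! ### Principal bundles -/

section PrincipalBundles

/-- A principal bundle `proj : E → B` with structure group `G`, which acts on `E` from the right:
`op g • e` is `e · g`. -/
structure PrincipalBundle (G : Type*) [Group G] [TopologicalSpace G] (E B : Type*)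
    [TopologicalSpace E] [TopologicalSpace B] [MulAction Gᵐᵒᵖ E] where
  /-- The bundle projection. -/
  proj : E → B
  continuous_proj : Continuous proj
  continuous_act : Continuous fun q : E × G => op q.2 • q.1
  proj_act : ∀ (e : E) (g : Gᵐᵒᵖ), proj (g • e) = proj e
  /-- There are equivariant local trivializations around every point. -/
  locally_trivial : ∀ b : B, ∃ t : Bundle.Trivialization G proj, b ∈ t.baseSet ∧
    ∀ e ∈ t.source, ∀ g : G, (t (op g • e)).2 = (t e).2 * g

variable {G : Type*} [Group G] [TopologicalSpace G] {E B : Type*}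
  [TopologicalSpace E] [TopologicalSpace B] [MulAction Gᵐᵒᵖ E]

/-- A principal bundle is universal if its total space is weakly contractible. -/
def PrincipalBundle.IsUniversal (_p : PrincipalBundle G E B) : Prop :=
  Nonempty E ∧ ∀ (n : ℕ) (e : E), Subsingleton (HomotopyGroup.Pi n E e)

/-- The total space of the pullback `f^* E = {(x, e) | f x = proj e}`. -/
def Pull (p : PrincipalBundle G E B) {X : Type*} (f : X → B) : Type _ :=
  {q : X × E // f q.1 = p.proj q.2}

variable {p : PrincipalBundle G E B} {X : Type*}

instance [TopologicalSpace X] (f : X → B) : TopologicalSpace (Pull p f) :=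
  inferInstanceAs (TopologicalSpace {q : X × E // f q.1 = p.proj q.2})

/-- The projection of a pullback to its base space. -/
def Pull.pt {f : X → B} (z : Pull p f) : X := z.1.1

theorem Pull.continuous_pt [TopologicalSpace X] {f : X → B} : Continuous (Pull.pt : Pull p f → X) :=
  continuous_fst.comp continuous_subtype_val

/-- `(x, e) · g = (x, e · g)`. -/
instance (f : X → B) : MulAction Gᵐᵒᵖ (Pull p f) where
  smul g z := ⟨(z.1.1, g • z.1.2), z.2.trans (p.proj_act _ g).symm⟩
  one_smul z := Subtype.ext (Prod.ext rfl (one_smul _ z.1.2))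
  mul_smul g g' z := Subtype.ext (Prod.ext rfl (mul_smul g g' z.1.2))

theorem Pull.smul_pt {f : X → B} (g : Gᵐᵒᵖ) (z : Pull p f) : (g • z).pt = z.pt := rfl

/-- The canonical map `(f ∘ ψ)^* E → f^* E`, `(y, e) ↦ (ψ y, e)`. -/
def Pull.baseChange [TopologicalSpace X] {Y : Type*} [TopologicalSpace Y] (f : X → B) (ψ : C(Y, X)) :
    C(Pull p (f ∘ ψ), Pull p f) where
  toFun z := ⟨(ψ z.1.1, z.1.2), z.2⟩
  continuous_toFun := Continuous.subtype_mk
    ((ψ.continuous.comp (continuous_fst.comp continuous_subtype_val)).prodMk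
      (continuous_snd.comp continuous_subtype_val)) _

variable {G₂ : Type*} [Group G₂] [TopologicalSpace G₂] (κ : G × G →* G₂)

/-- The fibre product `P ×_X P'` of two pullbacks. -/
abbrev FibreProduct (p : PrincipalBundle G E B) (f f' : X → B) : Type _ :=
  {q : Pull p f × Pull p f' // q.1.pt = q.2.pt}

/-- The relation `((z · g, z' · g'), a) ∼ ((z, z'), κ (g, g') a)` on `(P ×_X P') × G₂`. -/
def TensorRel {f f' : X → B} (u v : FibreProduct p f f' × G₂) : Prop :=
  ∃ g g' : G, u.1.1.1 = op g • v.1.1.1 ∧ u.1.1.2 = op g' • v.1.1.2 ∧ v.2 = κ (g, g') * u.2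

/-- The `G₂`-bundle `P ⊗ P' = (P ×_X P') ×_κ G₂` for the pullbacks `P` and `P'` of a principal
`G`-bundle along `f` and `f'`. -/
def BundleTensor (p : PrincipalBundle G E B) (f f' : X → B) : Type _ :=
  Quot (TensorRel κ (p := p) (f := f) (f' := f'))

namespace BundleTensor

variable {κ} [TopologicalSpace X] {f f' : X → B}

instance : TopologicalSpace (BundleTensor κ p f f') :=
  inferInstanceAs (TopologicalSpace (Quot (TensorRel κ (p := p) (f := f) (f' := f'))))

/-- The class `[q, a]`. -/
def mk (q : FibreProduct p f f') (a : G₂) : BundleTensor κ p f f' := Quot.mk _ (q, a)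

/-- The projection to the base space. -/
def pt : BundleTensor κ p f f' → X :=
  Quot.lift (fun u => u.1.1.1.pt) (by
    rintro u v ⟨g, g', h, -, -⟩
    rw [h, Pull.smul_pt])

theorem continuous_pt : Continuous (pt : BundleTensor κ p f f' → X) :=
  continuous_quot_lift _
    (Pull.continuous_pt.comp (continuous_fst.comp (continuous_subtype_val.comp continuous_fst)))

variable {Y : Type*} [TopologicalSpace Y] {k k' : Y → B}

/-- The map of fibre products induced by two maps `m`, `m'` covering the same map `φ` of base
spaces. -/
def fibreMap (φ : X → Y) (m : C(Pull p f, Pull p k)) (m' : C(Pull p f', Pull p k'))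
    (hm : ∀ z, (m z).pt = φ z.pt) (hm' : ∀ z, (m' z).pt = φ z.pt) :
    C(FibreProduct p f f', FibreProduct p k k') where
  toFun q := ⟨(m q.1.1, m' q.1.2), (hm _).trans ((congrArg φ q.2).trans (hm' _).symm)⟩
  continuous_toFun := Continuous.subtype_mk ((m.continuous.comp (continuous_fst.comp
    continuous_subtype_val)).prodMk (m'.continuous.comp (continuous_snd.comp
    continuous_subtype_val))) _

/-- The map `m ⊗ m'` that two equivariant maps `m`, `m'` covering the same map `φ` of base spaces
induce on tensor products, `[(z, z'), a] ↦ [(m z, m' z'), a]`. -/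
def map (φ : X → Y) (m : C(Pull p f, Pull p k)) (m' : C(Pull p f', Pull p k'))
    (hm : ∀ z, (m z).pt = φ z.pt) (hm' : ∀ z, (m' z).pt = φ z.pt)
    (em : ∀ z (g : Gᵐᵒᵖ), m (g • z) = g • m z) (em' : ∀ z (g : Gᵐᵒᵖ), m' (g • z) = g • m' z) :
    C(BundleTensor κ p f f', BundleTensor κ p k k') where
  toFun := Quot.map (fun u => (fibreMap φ m m' hm hm' u.1, u.2)) (by
    rintro u v ⟨g, g', h, h', h''⟩
    exact ⟨g, g', (congrArg m h).trans (em _ _), (congrArg m' h').trans (em' _ _), h''⟩)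
  continuous_toFun := continuous_quot_lift _ (continuous_quot_mk.comp
    (((fibreMap φ m m' hm hm').continuous.comp continuous_fst).prodMk continuous_snd))

end BundleTensor

end PrincipalBundles

/-! ### Finite CW complexes with twist data -/

section TwistedComplexes

variable {G : Type*} [Group G] [TopologicalSpace G] {E B : Type*}
  [TopologicalSpace E] [TopologicalSpace B] [MulAction Gᵐᵒᵖ E]
  {G₂ : Type*} [Group G₂] [TopologicalSpace G₂]

/-- A tuple `(X, f, f⁻, τ)` of a finite CW complex `X`, continuous maps `f, f⁻ : X → B` and a
trivialization `τ : f^* E ⊗ (f⁻)^* E → X × G₂`. As usual in Mathlib, the CW complex is a subset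
`carrier` of an ambient Hausdorff space; the space `X` is the subspace `carrier`.
A trivialization is a map of principal `G₂`-bundles covering the identity (which is automatically
an isomorphism); it is described on representatives `[q, a]`, on which `b` acts by
`[q, a] · b = [q, a b]`. -/
structure TwistedCW (κ : G × G →* G₂) (p : PrincipalBundle G E B) where
  /-- The ambient space. -/
  ambient : Type
  [top : TopologicalSpace ambient]
  [t2 : T2Space ambient]
  /-- The underlying set of the CW complex. -/
  carrier : Set ambient
  [cw : CWComplex carrier]
  [finite : CWComplex.Finite carrier]
  /-- The map classifying the first bundle. -/
  f : C(carrier, B)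
  /-- The map classifying the second bundle. -/
  fInv : C(carrier, B)
  /-- The trivialization of the tensor product of the two bundles. -/
  triv : C(BundleTensor κ p f fInv, carrier × G₂)
  triv_fst : ∀ z, (triv z).1 = z.pt
  triv_act : ∀ q a b, (triv (.mk q (a * b))).2 = (triv (.mk q a)).2 * b

attribute [instance] TwistedCW.top TwistedCW.t2 TwistedCW.cw TwistedCW.finite

namespace TwistedCW

variable {κ : G × G →* G₂} {p : PrincipalBundle G E B}

/-- A morphism `(φ, φ̂, φ̂⁻, ρ)`: a continuous map `φ`, maps `φ̂`, `φ̂⁻` of principal bundles covering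
`φ` and a change of trivialization `ρ`, which satisfy
`τ' ∘ (φ̂ ⊗ φ̂⁻) = λ_ρ ∘ τ`, where `λ_ρ (x, a) = (φ x, ρ x * a)`. -/
@[ext]
structure Hom (X Y : TwistedCW κ p) where
  /-- The map `φ` of spaces. -/
  base : C(X.carrier, Y.carrier)
  /-- The map `φ̂` of the first bundles. -/
  map : C(Pull p X.f, Pull p Y.f)
  /-- The map `φ̂⁻` of the second bundles. -/
  mapInv : C(Pull p X.fInv, Pull p Y.fInv)
  /-- The change of trivialization. -/
  rho : C(X.carrier, G₂)
  map_pt : ∀ z, (map z).pt = base z.pt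
  mapInv_pt : ∀ z, (mapInv z).pt = base z.pt
  map_act : ∀ z (g : Gᵐᵒᵖ), map (g • z) = g • map z
  mapInv_act : ∀ z (g : Gᵐᵒᵖ), mapInv (g • z) = g • mapInv z
  comm : ∀ z, Y.triv (BundleTensor.map base map mapInv map_pt mapInv_pt map_act mapInv_act z) =
    (base (X.triv z).1, rho (X.triv z).1 * (X.triv z).2)

variable [ContinuousMul G₂]

instance : Category (TwistedCW κ p) where
  Hom := Hom
  id X :=
    { base := .id _
      map := .id _
      mapInv := .id _
      rho := .const _ 1
      map_pt := fun _ => rfl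
      mapInv_pt := fun _ => rfl
      map_act := fun _ _ => rfl
      mapInv_act := fun _ _ => rfl
      comm := fun z => by
        induction z using Quot.ind
        simp only [ContinuousMap.const_apply, one_mul]
        rfl }
  comp {X Y Z} F F' :=
    { base := F'.base.comp F.base
      map := F'.map.comp F.map
      mapInv := F'.mapInv.comp F.mapInv
      rho := (F'.rho.comp F.base) * F.rho
      map_pt := fun z => (F'.map_pt _).trans (congrArg F'.base (F.map_pt z))
      mapInv_pt := fun z => (F'.mapInv_pt _).trans (congrArg F'.base (F.mapInv_pt z))
      map_act := fun z g => (congrArg F'.map (F.map_act z g)).trans (F'.map_act _ g)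
      mapInv_act := fun z g => (congrArg F'.mapInv (F.mapInv_act z g)).trans (F'.mapInv_act _ g)
      comm := fun z => by
        have h := F'.comm (BundleTensor.map F.base F.map F.mapInv F.map_pt F.mapInv_pt F.map_act
          F.mapInv_act z)
        rw [F.comm z] at h
        refine Eq.trans ?_ (h.trans ?_)
        · induction z using Quot.ind
          rfl
        · exact Prod.ext rfl (mul_assoc _ _ _).symm }
  id_comp F := Hom.ext rfl rfl rfl (ContinuousMap.ext fun _ => mul_one _)
  comp_id F := Hom.ext rfl rfl rfl (ContinuousMap.ext fun _ => one_mul _)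
  assoc F F' F'' := Hom.ext rfl rfl rfl (ContinuousMap.ext fun _ => (mul_assoc _ _ _).symm)

/-- Two morphisms are homotopic if they are joined by a family of morphisms that is continuous in
all four components. -/
def Homotopic {X Y : TwistedCW κ p} (F F' : X ⟶ Y) : Prop :=
  ∃ H : unitInterval → (X ⟶ Y), H 0 = F ∧ H 1 = F' ∧
    Continuous (fun q : X.carrier × unitInterval => (H q.2).base q.1) ∧
    Continuous (fun q : Pull p X.f × unitInterval => (H q.2).map q.1) ∧
    Continuous (fun q : Pull p X.fInv × unitInterval => (H q.2).mapInv q.1) ∧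
    Continuous (fun q : X.carrier × unitInterval => (H q.2).rho q.1)

section Pullback

variable (X : TwistedCW κ p) {Y : Type} [TopologicalSpace Y] [T2Space Y] (C : Set Y) [CWComplex C]
  [CWComplex.Finite C] (ψ : C(C, X.carrier))

/-- The canonical map `(f ∘ ψ)^* E ⊗ (f⁻ ∘ ψ)^* E → f^* E ⊗ (f⁻)^* E`. -/
def tensorBaseChange :
    C(BundleTensor κ p (X.f.comp ψ) (X.fInv.comp ψ), BundleTensor κ p X.f X.fInv) :=
  BundleTensor.map ψ (Pull.baseChange X.f ψ) (Pull.baseChange X.fInv ψ)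
    (fun _ => rfl) (fun _ => rfl) (fun _ _ => rfl) (fun _ _ => rfl)

/-- The pullback of all data along a continuous map `ψ` from a finite CW complex. -/
def pullback : TwistedCW κ p where
  ambient := Y
  carrier := C
  f := X.f.comp ψ
  fInv := X.fInv.comp ψ
  triv :=
    { toFun := fun z => (z.pt, (X.triv (X.tensorBaseChange C ψ z)).2)
      continuous_toFun := BundleTensor.continuous_pt.prodMk
        (continuous_snd.comp (X.triv.continuous.comp (X.tensorBaseChange C ψ).continuous)) }
  triv_fst _ := rfl
  triv_act _ _ _ := X.triv_act _ _ _

/-- The canonical morphism from a pullback along `ψ`, which covers `ψ`. -/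
def pullbackHom : X.pullback C ψ ⟶ X :=
  Hom.mk (X := X.pullback C ψ) (Y := X) ψ (Pull.baseChange X.f ψ) (Pull.baseChange X.fInv ψ)
    (.const _ 1) (fun _ => rfl) (fun _ => rfl) (fun _ _ => rfl) (fun _ _ => rfl) (fun z => by
      refine Prod.ext ((X.triv_fst _).trans ?_) (one_mul _).symm
      induction z using Quot.ind
      rfl)

end Pullback

section Subcomplexes

variable (X : TwistedCW κ p)

/-- The intersection of two subcomplexes. -/
def inter (A A' : CWComplex.Subcomplex X.carrier) : CWComplex.Subcomplex X.carrier where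
  carrier := A ∩ A'
  I n := A.I n ∩ A'.I n
  closed' := A.closed.inter A'.closed
  union' := by
    rw [Set.empty_union]
    ext x
    simp only [Set.mem_iUnion, Set.mem_inter_iff]
    constructor
    · rintro ⟨n, ⟨j, hj, hj'⟩, hx⟩
      exact ⟨CWComplex.Subcomplex.openCell_subset_of_mem A hj hx,
        CWComplex.Subcomplex.openCell_subset_of_mem A' hj' hx⟩
    · rintro ⟨hx, hx'⟩
      have h := hx
      rw [← CWComplex.Subcomplex.union] at h
      simp only [Set.mem_iUnion] at h
      obtain ⟨n, ⟨j, hj⟩, hxj⟩ := h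
      refine ⟨n, ⟨j, hj, ?_⟩, hxj⟩
      by_contra hj'
      exact (CWComplex.Subcomplex.disjoint_openCell_subcomplex_of_not_mem A' hj').notMem_of_mem_left
        hxj hx'

/-- A subcomplex of `X` with the restricted data. -/
def restrict (A : CWComplex.Subcomplex X.carrier) : TwistedCW κ p :=
  X.pullback (A : Set X.ambient)
    ⟨Set.inclusion A.subset_complex, continuous_inclusion A.subset_complex⟩

/-- The inclusion morphism of a subcomplex. -/
def incl (A : CWComplex.Subcomplex X.carrier) : X.restrict A ⟶ X :=
  X.pullbackHom _ _

/-- The inclusion morphism between nested subcomplexes. -/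
def inclOfSubset {A A' : CWComplex.Subcomplex X.carrier} (h : (A : Set X.ambient) ⊆ A') :
    X.restrict A ⟶ X.restrict A' :=
  Hom.mk (X := X.restrict A) (Y := X.restrict A') ⟨Set.inclusion h, continuous_inclusion h⟩
    (Pull.baseChange (X.restrict A').f ⟨Set.inclusion h, continuous_inclusion h⟩)
    (Pull.baseChange (X.restrict A').fInv ⟨Set.inclusion h, continuous_inclusion h⟩)
    (.const _ 1) (fun _ => rfl) (fun _ => rfl) (fun _ _ => rfl) (fun _ _ => rfl) (fun z => by
      induction z using Quot.ind
      exact Prod.ext rfl (one_mul _).symm)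

theorem inclOfSubset_comp_incl {A A' : CWComplex.Subcomplex X.carrier}
    (h : (A : Set X.ambient) ⊆ A') : X.inclOfSubset h ≫ X.incl A' = X.incl A :=
  Hom.ext rfl rfl rfl (ContinuousMap.ext fun _ => mul_one _)

/-- The inclusion of an intersection into the first subcomplex. -/
def interFst (A A' : CWComplex.Subcomplex X.carrier) : X.restrict (X.inter A A') ⟶ X.restrict A :=
  X.inclOfSubset Set.inter_subset_left

/-- The inclusion of an intersection into the second subcomplex. -/
def interSnd (A A' : CWComplex.Subcomplex X.carrier) : X.restrict (X.inter A A') ⟶ X.restrict A' :=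
  X.inclOfSubset Set.inter_subset_right

end Subcomplexes

/-! ### Homotopy invariant functors with Mayer-Vietoris sequences -/

section Functors

/-- Homotopic morphisms induce the same map. -/
def HomotopyInvariant (h : TwistedCW κ p ⥤ GradedObject ℤ AddCommGrpCat.{w}) : Prop :=
  ∀ ⦃X Y : TwistedCW κ p⦄ (F F' : X ⟶ Y), Homotopic F F' → h.map F = h.map F'

/-- The map induced in degree `k` by a morphism. -/
def ind (h : TwistedCW κ p ⥤ GradedObject ℤ AddCommGrpCat.{w}) {X Y : TwistedCW κ p} (F : X ⟶ Y)
    (k : ℤ) : h.obj X k →+ h.obj Y k :=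
  (h.map F k).hom

/-- The map `h_k(A ∩ B) → h_k(A) ⊕ h_k(B)`, `x ↦ (x|_A, x|_B)`. -/
def toSum (h : TwistedCW κ p ⥤ GradedObject ℤ AddCommGrpCat.{w}) (X : TwistedCW κ p)
    (A A' : CWComplex.Subcomplex X.carrier) (k : ℤ) :
    h.obj (X.restrict (X.inter A A')) k →+ h.obj (X.restrict A) k × h.obj (X.restrict A') k :=
  (ind h (X.interFst A A') k).prod (ind h (X.interSnd A A') k)

/-- The map `h_k(A) ⊕ h_k(B) → h_k(X)`, `(a, b) ↦ a - b`. -/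
def fromSum (h : TwistedCW κ p ⥤ GradedObject ℤ AddCommGrpCat.{w}) (X : TwistedCW κ p)
    (A A' : CWComplex.Subcomplex X.carrier) (k : ℤ) :
    h.obj (X.restrict A) k × h.obj (X.restrict A') k →+ h.obj X k :=
  (ind h (X.incl A) k).coprod (-ind h (X.incl A') k)

/-- Mayer-Vietoris sequences for `h`: boundary maps `∂ : h_k(X) → h_{k-1}(A ∩ A')` for all
subcomplexes `A`, `A'` with `X = A ∪ A'`, which are natural with respect to morphisms `X → Y` that
map `A` to `B` and `A'` to `B'`, such that the long Mayer-Vietoris sequence is exact. -/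
structure MayerVietoris (h : TwistedCW κ p ⥤ GradedObject ℤ AddCommGrpCat.{w}) where
  /-- The boundary map. -/
  bd (X : TwistedCW κ p) (A A' : CWComplex.Subcomplex X.carrier)
    (hX : (A : Set X.ambient) ∪ A' = X.carrier) (k : ℤ) :
    h.obj X k →+ h.obj (X.restrict (X.inter A A')) (k - 1)
  natural (X Y : TwistedCW κ p) (A A' : CWComplex.Subcomplex X.carrier)
    (hX : (A : Set X.ambient) ∪ A' = X.carrier) (B B' : CWComplex.Subcomplex Y.carrier)
    (hY : (B : Set Y.ambient) ∪ B' = Y.carrier) (F : X ⟶ Y)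
    (hA : ∀ x : X.carrier, (x : X.ambient) ∈ A → (F.base x : Y.ambient) ∈ B)
    (hA' : ∀ x : X.carrier, (x : X.ambient) ∈ A' → (F.base x : Y.ambient) ∈ B')
    (R : X.restrict (X.inter A A') ⟶ Y.restrict (Y.inter B B'))
    (hR : R ≫ Y.incl (Y.inter B B') = X.incl (X.inter A A') ≫ F) (k : ℤ) (x : h.obj X k) :
    bd Y B B' hY k (ind h F k x) = ind h R (k - 1) (bd X A A' hX k x)
  exact_sum (X : TwistedCW κ p) (A A' : CWComplex.Subcomplex X.carrier)
    (hX : (A : Set X.ambient) ∪ A' = X.carrier) (k : ℤ) :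
    Function.Exact (toSum h X A A' k) (fromSum h X A A' k)
  exact_total (X : TwistedCW κ p) (A A' : CWComplex.Subcomplex X.carrier)
    (hX : (A : Set X.ambient) ∪ A' = X.carrier) (k : ℤ) :
    Function.Exact (fromSum h X A A' k) (bd X A A' hX k)
  exact_inter (X : TwistedCW κ p) (A A' : CWComplex.Subcomplex X.carrier)
    (hX : (A : Set X.ambient) ∪ A' = X.carrier) (k : ℤ) :
    Function.Exact (bd X A A' hX k) (toSum h X A A' (k - 1))

/-- A natural transformation is compatible with Mayer-Vietoris sequences if it commutes with the
boundary maps. -/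
def Compatible {h h' : TwistedCW κ p ⥤ GradedObject ℤ AddCommGrpCat.{w}} (mv : MayerVietoris h)
    (mv' : MayerVietoris h') (η : h ⟶ h') : Prop :=
  ∀ (X : TwistedCW κ p) (A A' : CWComplex.Subcomplex X.carrier)
    (hX : (A : Set X.ambient) ∪ A' = X.carrier) (k : ℤ) (x : h.obj X k),
    mv'.bd X A A' hX k ((η.app X k).hom x) =
      (η.app (X.restrict (X.inter A A')) (k - 1)).hom (mv.bd X A A' hX k x)

end Functors

end TwistedCW
end TwistedComplexes

section Category

variable (D : Type u) [CStarAlgebra D]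

/-- The topological group `Aut (D ⊗ 𝕂)`. -/
abbrev AutStab : Type u := Stabilization D ≃⋆ₐ[ℂ] Stabilization D

/-- The topological group `Aut ((D ⊗ 𝕂) ⊗ (D ⊗ 𝕂))`. -/
abbrev AutStabSq : Type u :=
  SpatialTensor (Stabilization D) (Stabilization D) ≃⋆ₐ[ℂ]
    SpatialTensor (Stabilization D) (Stabilization D)

/-- The category `CW_D` of finite CW complexes `X` with classifying maps `f, f⁻ : X → B` for
principal `Aut (D ⊗ 𝕂)`-bundles `P` and `P⁻` and a trivialization of `P ⊗ P⁻`; here `E → B` is a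
universal principal `Aut (D ⊗ 𝕂)`-bundle. -/
abbrev CWD {E B : Type*} [TopologicalSpace E] [TopologicalSpace B] [MulAction (AutStab D)ᵐᵒᵖ E]
    (p : PrincipalBundle (AutStab D) E B) : Type _ :=
  TwistedCW (tensorAutHom (Stabilization D) (Stabilization D)) p

end Category

end

end HigherTwist

/-! The statement follows by induction over cells, with the five lemma applied to Mayer-Vietoris
sequences as the algebraic step (`isIso_app_of_union`). The difficulty is geometric: a closed cell
need not be embedded, so it cannot be split off directly with its boundary sphere as the
intersection. Instead a cell of maximal dimension n + 1 is cut along the sphere of radius 1/2 in its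
cube. The complex becomes K ∪ L, where L is the image of the closed cube of radius 1/2 and K is
everything outside the interior of L. Then K deformation retracts radially to the complex A without
the cell, L contracts to a point, and K ∩ L is a sphere with cells of dimension at most n. A double
induction, over a bound on the dimension and over the number of cells, ends at points and the empty
space (`CellInductive.carrier_of_dim_lt`).

For K and L to be subcomplexes, the cell is subdivided into five cells
(`CellStructure.exists_subdivision`): a vertex and an n-cell forming the inner sphere, an edge
joining that vertex to the outer boundary, the remaining shell, and the inner cube. The edge has to
end at a vertex of A, which is arranged by subdividing A beforehand (`CellStructure.exists_vertex`).

The twist data enter only through homotopy invariance. A homotopy of the base that starts at the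
identity is covered by a homotopy of morphisms (`exists_lift_homotopy`): both bundle maps come from
the covering homotopy theorem for principal bundles over a compact Hausdorff space
(`PrincipalBundle.liftsUpTo_one`), and the change of trivialization is then forced (`exists_rho`).
Hence passing to a deformation retract induces isomorphisms for both functors
(`isIso_map_pullbackHom`).

With a constant homotopy, the same result shows that the CW structure of an object may be replaced
by any other finite one. The induction can therefore run over a property of subsets of one fixed
Hausdorff space, abstracted as `CellInductive`, in which subdivisions of the same set are
interchangeable. -/

namespace HigherTwist

open Set Metric

/-! ### Finite cell structures -/

/-- The inverse of a continuous map on a compact set is continuous on the image of every subset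
on which the map is injective and which is saturated. -/
theorem continuousOn_invOn_of_isCompact {W Y : Type*} [TopologicalSpace W] [TopologicalSpace Y]
    [T2Space Y] {Φ : W → Y} {Ψ : Y → W} {K U : Set W} (hK : IsCompact K) (hΦ : ContinuousOn Φ K)
    (hUK : U ⊆ K) (hinv : ∀ x ∈ U, Ψ (Φ x) = x) (hinj : ∀ x ∈ U, ∀ y ∈ K, Φ x = Φ y → x = y) :
    ContinuousOn Ψ (Φ '' U) := by
  rw [continuousOn_iff_isClosed]
  intro t ht
  -- Images of closed subsets of `K` are compact, hence closed. On `Φ '' U` such an image is the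
  -- preimage of `t` under `Ψ`, because no point of `K` outside `U` shares its value with a point of
  -- `U`.
  refine ⟨Φ '' (K ∩ t), ((hK.inter_right ht).image_of_continuousOn
    (hΦ.mono inter_subset_left)).isClosed, ?_⟩
  ext y
  constructor
  · rintro ⟨hy, x, hx, rfl⟩
    rw [mem_preimage, hinv x hx] at hy
    exact ⟨⟨x, ⟨hUK hx, hy⟩, rfl⟩, x, hx, rfl⟩
  · rintro ⟨⟨z, hz, hzx⟩, x, hx, rfl⟩
    obtain rfl := hinj x hx z hz.1 hzx.symm
    exact ⟨by rw [mem_preimage, hinv x hx]; exact hz.2, x, hx, rfl⟩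

/-- A finite family of cells in a space, given by characteristic maps on cubes, such that the open
cells are disjoint and the frontier of every cell lies in the union of the open cells of smaller
dimension. -/
structure CellStructure (Y : Type) [TopologicalSpace Y] where
  /-- The index set of the cells. -/
  ι : Type
  [finite : Finite ι]
  /-- The dimensions of the cells. -/
  dim : ι → ℕ
  /-- The characteristic maps of the cells. -/
  map : (i : ι) → (Fin (dim i) → ℝ) → Y
  continuousOn : ∀ i, ContinuousOn (map i) (closedBall 0 1)
  injOn : ∀ i, InjOn (map i) (ball 0 1)
  disjoint : ∀ i j, i ≠ j → Disjoint (map i '' ball 0 1) (map j '' ball 0 1)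
  frontier : ∀ i, ∀ x ∈ sphere (0 : Fin (dim i) → ℝ) 1, ∃ j, dim j < dim i ∧
    map i x ∈ map j '' ball 0 1

attribute [instance] CellStructure.finite

namespace CellStructure

variable {Y : Type} [TopologicalSpace Y]

/-- An open cell. -/
def cell (D : CellStructure Y) (i : D.ι) : Set Y := D.map i '' ball 0 1

/-- The union of all cells. -/
def carrier (D : CellStructure Y) : Set Y := ⋃ i, D.cell i

/-- The union of all cells of dimension less than `k`. -/
def skel (D : CellStructure Y) (k : ℕ) : Set Y := {y | ∃ i, D.dim i < k ∧ y ∈ D.cell i}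

/-- Unions of open cells. -/
def IsUnion (D : CellStructure Y) (K : Set Y) : Prop := ∃ s : Set D.ι, K = ⋃ i ∈ s, D.cell i

variable (D : CellStructure Y)

theorem mem_carrier {y : Y} : y ∈ D.carrier ↔ ∃ i, y ∈ D.cell i := mem_iUnion

theorem cell_subset_carrier (i : D.ι) : D.cell i ⊆ D.carrier := subset_iUnion _ i

theorem skel_subset_carrier (k : ℕ) : D.skel k ⊆ D.carrier :=
  fun _ ⟨i, _, hi⟩ => D.cell_subset_carrier i hi

theorem skel_mono {k l : ℕ} (h : k ≤ l) : D.skel k ⊆ D.skel l :=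
  fun _ ⟨i, hk, hi⟩ => ⟨i, hk.trans_le h, hi⟩

theorem map_mem_skel {i : D.ι} {x : Fin (D.dim i) → ℝ} (hx : x ∈ sphere 0 1) :
    D.map i x ∈ D.skel (D.dim i) := D.frontier i x hx

theorem map_mem_carrier {i : D.ι} {x : Fin (D.dim i) → ℝ} (hx : x ∈ closedBall 0 1) :
    D.map i x ∈ D.carrier := by
  rw [← ball_union_sphere] at hx
  rcases hx with hx | hx
  · exact D.cell_subset_carrier i ⟨x, hx, rfl⟩
  · exact D.skel_subset_carrier _ (D.map_mem_skel hx)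

theorem eq_of_mem_cell {i j : D.ι} {y : Y} (hi : y ∈ D.cell i) (hj : y ∈ D.cell j) : i = j := by
  by_contra hij
  exact (D.disjoint i j hij).notMem_of_mem_left hi hj

theorem notMem_cell_of_mem_skel {i : D.ι} {y : Y} (hy : y ∈ D.skel (D.dim i)) : y ∉ D.cell i := by
  obtain ⟨j, hj, hyj⟩ := hy
  intro hyi
  obtain rfl := D.eq_of_mem_cell hyi hyj
  exact hj.false

/-- The frontier lies in cells of smaller dimension, which miss the open cell, so no boundary point
is identified with an interior one. This is the saturation needed for continuity of the inverse of a
characteristic map. -/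
theorem eq_of_map_eq {i : D.ι} {x z : Fin (D.dim i) → ℝ} (hx : x ∈ ball 0 1)
    (hz : z ∈ closedBall 0 1) (h : D.map i x = D.map i z) : x = z := by
  rw [← ball_union_sphere] at hz
  rcases hz with hz | hz
  · exact D.injOn i hx hz h
  · exact absurd ⟨x, hx, h⟩ (D.notMem_cell_of_mem_skel (D.map_mem_skel hz))

theorem isCompact_image (i : D.ι) : IsCompact (D.map i '' closedBall 0 1) :=
  (isCompact_closedBall _ _).image_of_continuousOn (D.continuousOn i)

theorem carrier_eq : D.carrier = ⋃ i, D.map i '' closedBall 0 1 := by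
  refine subset_antisymm (iUnion_mono fun i => image_mono ball_subset_closedBall)
    (iUnion_subset fun i => ?_)
  rintro _ ⟨x, hx, rfl⟩
  exact D.map_mem_carrier hx

theorem isCompact_carrier : IsCompact D.carrier := by
  rw [carrier_eq]
  exact isCompact_iUnion D.isCompact_image

theorem isUnion_cell (i : D.ι) : D.IsUnion (D.cell i) := ⟨{i}, by simp⟩

theorem IsUnion.union {D : CellStructure Y} {K L : Set Y} (hK : D.IsUnion K) (hL : D.IsUnion L) :
    D.IsUnion (K ∪ L) := by
  obtain ⟨s, rfl⟩ := hK
  obtain ⟨t, rfl⟩ := hL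
  exact ⟨s ∪ t, (biUnion_union s t _).symm⟩

theorem isUnion_carrier : D.IsUnion D.carrier := ⟨univ, by simp [carrier]⟩

/-- The empty cell structure. -/
def empty (Y : Type) [TopologicalSpace Y] : CellStructure Y where
  ι := Empty
  dim := Empty.elim
  map i := i.elim
  continuousOn i := i.elim
  injOn i := i.elim
  disjoint i := i.elim
  frontier i := i.elim

theorem carrier_empty : (empty Y).carrier = ∅ := by
  rw [eq_empty_iff_forall_notMem]
  intro y hy
  obtain ⟨i, -⟩ := (mem_carrier _).mp hy
  exact i.elim

section Attach

variable {m : ℕ} (Φ : (Fin m → ℝ) → Y) (hc : ContinuousOn Φ (closedBall 0 1))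
  (hi : InjOn Φ (ball 0 1)) (hd : ∀ x ∈ ball 0 1, Φ x ∉ D.carrier)
  (hf : ∀ x ∈ sphere 0 1, Φ x ∈ D.skel m)

/-- Attaching one cell to a cell structure. -/
def attach : CellStructure Y where
  ι := Option D.ι
  dim o := match o with
    | none => m
    | some i => D.dim i
  map o := match o with
    | none => Φ
    | some i => D.map i
  continuousOn o := match o with
    | none => hc
    | some i => D.continuousOn i
  injOn o := match o with
    | none => hi
    | some i => D.injOn i
  disjoint o o' h := by
    match o, o', h with
    | none, none, h => exact absurd rfl h
    | none, some j, _ =>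
      rw [disjoint_left]
      rintro _ ⟨x, hx, rfl⟩ h'
      exact hd x hx (D.cell_subset_carrier j h')
    | some i, none, _ =>
      rw [disjoint_right]
      rintro _ ⟨x, hx, rfl⟩ h'
      exact hd x hx (D.cell_subset_carrier i h')
    | some i, some j, h => exact D.disjoint i j (fun e => h (congrArg some e))
  frontier o := by
    match o with
    | none =>
      intro x hx
      obtain ⟨j, hj, hj'⟩ := hf x hx
      exact ⟨some j, hj, hj'⟩
    | some i =>
      intro x hx
      obtain ⟨j, hj, hj'⟩ := D.frontier i x hx
      exact ⟨some j, hj, hj'⟩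

theorem mem_carrier_attach {y : Y} :
    y ∈ (D.attach Φ hc hi hd hf).carrier ↔ y ∈ D.carrier ∨ y ∈ Φ '' ball 0 1 := by
  rw [mem_carrier, mem_carrier]
  constructor
  · rintro ⟨_ | i, h⟩
    · exact Or.inr h
    · exact Or.inl ⟨i, h⟩
  · rintro (⟨i, h⟩ | h)
    · exact ⟨some i, h⟩
    · exact ⟨none, h⟩

theorem carrier_attach : (D.attach Φ hc hi hd hf).carrier = D.carrier ∪ Φ '' ball 0 1 :=
  Set.ext fun _ => D.mem_carrier_attach Φ hc hi hd hf

theorem skel_subset_skel_attach (k : ℕ) : D.skel k ⊆ (D.attach Φ hc hi hd hf).skel k := by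
  rintro y ⟨i, h, h'⟩
  exact ⟨some i, h, h'⟩

theorem image_subset_skel_attach {k : ℕ} (hk : m < k) :
    Φ '' ball 0 1 ⊆ (D.attach Φ hc hi hd hf).skel k :=
  fun _ hy => ⟨none, hk, hy⟩

theorem isUnion_attach : (D.attach Φ hc hi hd hf).IsUnion (Φ '' ball 0 1) :=
  (D.attach Φ hc hi hd hf).isUnion_cell none

theorem IsUnion.attach {D : CellStructure Y} {hd : ∀ x ∈ ball 0 1, Φ x ∉ D.carrier}
    {hf : ∀ x ∈ sphere 0 1, Φ x ∈ D.skel m} {K : Set Y} (hK : D.IsUnion K) :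
    (D.attach Φ hc hi hd hf).IsUnion K := by
  obtain ⟨s, rfl⟩ := hK
  exact ⟨some '' s, (biUnion_image (s := s) (f := some)
    (g := (D.attach Φ hc hi hd hf).cell)).symm⟩

/-- `D'` is obtained from `D` by attaching an open cell `e` of dimension `m`. -/
structure IsAttached (D D' : CellStructure Y) (m : ℕ) (e : Set Y) : Prop where
  carrier_eq : D'.carrier = D.carrier ∪ e
  skel_subset : ∀ k, D.skel k ⊆ D'.skel k
  cell_subset : ∀ k, m < k → e ⊆ D'.skel k
  isUnion : ∀ K, D.IsUnion K → D'.IsUnion K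
  isUnion_cell : D'.IsUnion e
  dim_lt : ∀ N, (∀ i, D.dim i < N) → m < N → ∀ i, D'.dim i < N

theorem isAttached_attach : IsAttached D (D.attach Φ hc hi hd hf) m (Φ '' ball 0 1) where
  carrier_eq := D.carrier_attach Φ hc hi hd hf
  skel_subset := D.skel_subset_skel_attach Φ hc hi hd hf
  cell_subset _ := D.image_subset_skel_attach Φ hc hi hd hf
  isUnion _ := IsUnion.attach Φ hc hi
  isUnion_cell := D.isUnion_attach Φ hc hi hd hf
  dim_lt _ h h' o := match o with
    | none => h'
    | some i => h i

end Attach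

section Remove

/-- Removing a cell of maximal dimension. -/
def remove (i : D.ι) (hi : ∀ j, D.dim j ≤ D.dim i) : CellStructure Y where
  ι := {j // j ≠ i}
  dim j := D.dim j
  map j := D.map j
  continuousOn j := D.continuousOn j
  injOn j := D.injOn j
  disjoint j k h := D.disjoint j k (fun e => h (Subtype.ext e))
  frontier j x hx := by
    obtain ⟨k, hk, hk'⟩ := D.frontier j x hx
    -- By maximality of `dim i`, a cell met by the frontier of `j` has dimension less than `dim i`,
    -- so it is not the removed one.
    exact ⟨⟨k, fun e => (hk.trans_le (hi j)).ne (congrArg D.dim e)⟩, hk, hk'⟩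

variable (i : D.ι) (hi : ∀ j, D.dim j ≤ D.dim i)

theorem carrier_eq_remove : D.carrier = (D.remove i hi).carrier ∪ D.cell i := by
  ext y
  rw [mem_union, mem_carrier, mem_carrier]
  constructor
  · rintro ⟨j, h⟩
    by_cases hj : j = i
    · exact Or.inr (hj ▸ h)
    · exact Or.inl ⟨⟨j, hj⟩, h⟩
  · rintro (⟨j, h⟩ | h)
    · exact ⟨j.1, h⟩
    · exact ⟨i, h⟩

theorem notMem_remove {y : Y} (hy : y ∈ D.cell i) : y ∉ (D.remove i hi).carrier := by
  rw [mem_carrier]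
  rintro ⟨j, h⟩
  exact j.2 (D.eq_of_mem_cell h hy)

theorem skel_subset_skel_remove : D.skel (D.dim i) ⊆ (D.remove i hi).skel (D.dim i) := by
  rintro y ⟨j, h, h'⟩
  exact ⟨⟨j, fun e => h.ne (congrArg D.dim e)⟩, h, h'⟩

theorem mem_skel_remove {k : ℕ} {y : Y} (hy : y ∈ D.skel k) :
    y ∈ (D.remove i hi).skel k ∨ D.dim i < k ∧ y ∈ D.cell i := by
  obtain ⟨j, h, h'⟩ := hy
  by_cases hj : j = i
  · subst hj
    exact Or.inr ⟨h, h'⟩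
  · exact Or.inl ⟨⟨j, hj⟩, h, h'⟩

theorem card_remove_lt : Nat.card (D.remove i hi).ι < Nat.card D.ι := by
  have := Fintype.ofFinite D.ι
  exact Finite.card_subtype_lt (p := fun j => j ≠ i) (x := i) (fun h => h rfl)

theorem exists_dim_max (h : Nonempty D.ι) : ∃ i, ∀ j, D.dim j ≤ D.dim i :=
  Finite.exists_max D.dim

end Remove

section CWComplexes

/-- The cell structure of a finite CW complex. -/
def ofCWComplex (C : Set Y) [CWComplex C] [CWComplex.Finite C] : CellStructure Y where
  ι := Σ n, RelCWComplex.cell C n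
  finite := CWComplex.finite_cells_of_finite
  dim := Sigma.fst
  map i := RelCWComplex.map i.1 i.2
  continuousOn i := RelCWComplex.continuousOn i.1 i.2
  injOn i := by
    have h := (RelCWComplex.map (C := C) i.1 i.2).injOn
    rwa [RelCWComplex.source_eq] at h
  disjoint i j h := CWComplex.disjoint_openCell_of_ne h
  frontier i x hx := by
    obtain ⟨I, hI⟩ := CWComplex.cellFrontier_subset_finite_openCell (C := C) i.1 i.2
    have h := hI ⟨x, hx, rfl⟩
    simp only [mem_iUnion] at h
    obtain ⟨m, hm, j, -, hj⟩ := h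
    exact ⟨⟨m, j⟩, hm, hj⟩

theorem carrier_ofCWComplex (C : Set Y) [CWComplex C] [CWComplex.Finite C] :
    (ofCWComplex C).carrier = C := by
  rw [carrier_eq]
  conv_rhs => rw [← CWComplex.union (C := C)]
  exact iUnion_sigma (fun i : Σ n, RelCWComplex.cell C n => RelCWComplex.closedCell i.1 i.2)

/-- The weaker form of the frontier condition, with closed cells, that `CWComplex.mkFinite` asks
for. -/
theorem image_closedBall_subset (i : D.ι) : ∀ x ∈ sphere (0 : Fin (D.dim i) → ℝ) 1,
    ∃ j, D.dim j < D.dim i ∧ D.map i x ∈ D.map j '' closedBall 0 1 := fun x hx => by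
  obtain ⟨j, hj, hj'⟩ := D.frontier i x hx
  exact ⟨j, hj, image_mono ball_subset_closedBall hj'⟩

theorem eventually_isEmpty : ∀ᶠ n in Filter.atTop, IsEmpty {i : D.ι // D.dim i = n} := by
  obtain ⟨N, hN⟩ := (finite_range D.dim).bddAbove
  filter_upwards [Filter.eventually_gt_atTop N] with n hn
  exact ⟨fun i => (hN ⟨i.1, i.2⟩).not_gt hn⟩

variable [T2Space Y]

/-- A characteristic map as a partial equivalence. -/
noncomputable def partialEquiv (i : D.ι) : PartialEquiv (Fin (D.dim i) → ℝ) Y :=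
  (D.injOn i).bijOn_image.toPartialEquiv _ _ _

theorem continuousOn_partialEquiv_symm (i : D.ι) :
    ContinuousOn (D.partialEquiv i).symm (D.partialEquiv i).target :=
  continuousOn_invOn_of_isCompact (isCompact_closedBall 0 1) (D.continuousOn i)
    ball_subset_closedBall (fun _ hx => (D.partialEquiv i).left_inv hx)
    (fun _ hx _ hz h => D.eq_of_map_eq hx hz h)

/-- The characteristic map of a cell of given dimension. -/
noncomputable def charMap (n : ℕ) (i : {i : D.ι // D.dim i = n}) : PartialEquiv (Fin n → ℝ) Y :=
  i.2 ▸ D.partialEquiv i.1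

/-- The finite CW complex given by a cell structure. -/
noncomputable abbrev toCWComplex : CWComplex D.carrier :=
  CWComplex.mkFinite D.carrier (fun n => {i : D.ι // D.dim i = n}) D.charMap
    D.eventually_isEmpty
    (fun _ => inferInstance)
    (by rintro n ⟨i, rfl⟩; rfl)
    (by rintro n ⟨i, rfl⟩; exact D.continuousOn i)
    (by rintro n ⟨i, rfl⟩; exact D.continuousOn_partialEquiv_symm i)
    (by
      rintro ⟨n, ⟨i, rfl⟩⟩ - ⟨m, ⟨j, rfl⟩⟩ - h
      refine D.disjoint i j fun e => h ?_
      subst e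
      rfl)
    (by
      rintro n ⟨i, rfl⟩ x hx
      obtain ⟨j, hj, hj'⟩ := D.image_closedBall_subset i x hx
      simp only [mem_iUnion]
      exact ⟨D.dim j, hj, ⟨j, rfl⟩, hj'⟩)
    (by
      rw [carrier_eq]
      ext y
      simp only [mem_iUnion]
      constructor
      · rintro ⟨n, ⟨i, rfl⟩, h⟩
        exact ⟨i, h⟩
      · rintro ⟨i, h⟩
        exact ⟨D.dim i, ⟨i, rfl⟩, h⟩)

theorem finite_toCWComplex : letI := D.toCWComplex; CWComplex.Finite D.carrier :=
  CWComplex.finite_mkFinite ..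

/-- A closed union of cells is a subcomplex. -/
theorem exists_subcomplex {K : Set Y} (hK : D.IsUnion K) (hc : IsClosed K) :
    letI := D.toCWComplex
    ∃ A : CWComplex.Subcomplex D.carrier, (A : Set Y) = K := by
  let := D.toCWComplex
  obtain ⟨s, hs⟩ := hK
  refine ⟨{ carrier := K
            I := fun n => {i : {i : D.ι // D.dim i = n} | i.1 ∈ s}
            closed' := hc
            union' := ?_ }, rfl⟩
  rw [empty_union, hs]
  ext y
  simp only [mem_iUnion]
  constructor
  · rintro ⟨n, ⟨⟨i, rfl⟩, hi⟩, h⟩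
    exact ⟨i, hi, h⟩
  · rintro ⟨i, hi, h⟩
    exact ⟨D.dim i, ⟨⟨i, rfl⟩, hi⟩, h⟩

end CWComplexes

end CellStructure

end HigherTwist

namespace HigherTwist

open Set Metric

/-! ### Subdivision of cubes -/

section Cubes

variable {n : ℕ}

theorem norm_cons (c : ℝ) (s : Fin n → ℝ) : ‖(Fin.cons c s : Fin (n + 1) → ℝ)‖ = max |c| ‖s‖ := by
  refine le_antisymm ((pi_norm_le_iff_of_nonneg (by positivity)).mpr fun i => ?_) (max_le ?_ ?_)
  · refine Fin.cases ?_ (fun j => ?_) i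
    · exact le_max_left _ _
    · exact (norm_le_pi_norm s j).trans (le_max_right _ _)
  · exact norm_le_pi_norm (Fin.cons c s : Fin (n + 1) → ℝ) 0
  · exact (pi_norm_le_iff_of_nonneg (norm_nonneg _)).mpr fun j =>
      norm_le_pi_norm (Fin.cons c s : Fin (n + 1) → ℝ) j.succ

theorem norm_eq_max_tail (x : Fin (n + 1) → ℝ) : ‖x‖ = max |x 0| ‖Fin.tail x‖ := by
  rw [← norm_cons, Fin.cons_self_tail]

theorem smul_cons (a c : ℝ) (s : Fin n → ℝ) :
    a • (Fin.cons c s : Fin (n + 1) → ℝ) = Fin.cons (a * c) (a • s) := by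
  funext i
  refine Fin.cases rfl (fun j => rfl) i

theorem cons_eq_cons {c d : ℝ} {s t : Fin n → ℝ}
    (h : (Fin.cons c s : Fin (n + 1) → ℝ) = Fin.cons d t) : c = d ∧ s = t :=
  Fin.cons_inj.mp h

variable (n) in
/-- The base point of the boundary of a cube. -/
def pole : Fin (n + 1) → ℝ := Fin.cons (-1) 0

theorem norm_pole : ‖pole n‖ = 1 := by
  rw [pole, norm_cons]
  simp

/-- A nonzero vector in the direction of `wrap s`. -/
def wrapVec (s : Fin n → ℝ) : Fin (n + 1) → ℝ := Fin.cons (1 - 2 * ‖s‖) ((1 - ‖s‖) • s)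

theorem wrapVec_ne_zero (s : Fin n → ℝ) : wrapVec s ≠ 0 := by
  intro h
  have h0 : wrapVec s = Fin.cons 0 0 := by
    rw [h]
    funext i
    refine Fin.cases rfl (fun j => rfl) i
  obtain ⟨h1, h2⟩ := cons_eq_cons h0
  have h3 : ‖s‖ = 1 / 2 := by linarith
  rw [h3, smul_eq_zero] at h2
  rcases h2 with h2 | h2
  · norm_num at h2
  · rw [h2, norm_zero] at h3
    norm_num at h3

theorem continuous_wrapVec : Continuous (wrapVec : (Fin n → ℝ) → Fin (n + 1) → ℝ) := by
  refine continuous_pi fun i => ?_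
  refine Fin.cases ?_ (fun j => ?_) i
  · change Continuous fun s : Fin n → ℝ => 1 - 2 * ‖s‖
    fun_prop
  · change Continuous fun s : Fin n → ℝ => (1 - ‖s‖) * s j
    fun_prop

/-- The map from a cube onto the boundary of a cube of one dimension more that collapses the
boundary to the base point and is injective on the interior. -/
noncomputable def wrap (s : Fin n → ℝ) : Fin (n + 1) → ℝ := ‖wrapVec s‖⁻¹ • wrapVec s

theorem continuous_wrap : Continuous (wrap : (Fin n → ℝ) → Fin (n + 1) → ℝ) :=
  (continuous_wrapVec.norm.inv₀ fun s => norm_ne_zero_iff.mpr (wrapVec_ne_zero s)).smul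
    continuous_wrapVec

theorem norm_wrap (s : Fin n → ℝ) : ‖wrap s‖ = 1 := by
  rw [wrap, norm_smul, norm_inv, norm_norm,
    inv_mul_cancel₀ (norm_ne_zero_iff.mpr (wrapVec_ne_zero s))]

theorem wrap_eq_of_wrapVec_eq {s : Fin n → ℝ} {u : Fin (n + 1) → ℝ} {c : ℝ} (hc : 0 < c)
    (hu : ‖u‖ = 1) (h : wrapVec s = c • u) : wrap s = u := by
  rw [wrap, h, norm_smul, hu, Real.norm_of_nonneg hc.le, mul_one, smul_smul,
    inv_mul_cancel₀ hc.ne', one_smul]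

theorem wrap_eq_pole {s : Fin n → ℝ} (hs : ‖s‖ = 1) : wrap s = pole n := by
  refine wrap_eq_of_wrapVec_eq one_pos norm_pole ?_
  rw [one_smul, wrapVec, pole, hs]
  norm_num

theorem wrap_injective {s t : Fin n → ℝ} (hs : ‖s‖ < 1) (ht : ‖t‖ ≤ 1) (h : wrap s = wrap t) :
    s = t := by
  obtain ⟨c, hc, h⟩ : ∃ c : ℝ, 0 < c ∧ wrapVec s = c • wrapVec t := by
    have h1 := norm_pos_iff.mpr (wrapVec_ne_zero s)
    have h2 := norm_pos_iff.mpr (wrapVec_ne_zero t)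
    refine ⟨‖wrapVec s‖ * ‖wrapVec t‖⁻¹, by positivity, ?_⟩
    rw [mul_smul]
    change _ = ‖wrapVec s‖ • wrap t
    rw [← h, wrap, smul_smul, mul_inv_cancel₀ h1.ne', one_smul]
  rw [wrapVec, wrapVec, smul_cons] at h
  obtain ⟨h1, h2⟩ := cons_eq_cons h
  have h3 : (1 - ‖s‖) * ‖s‖ = c * ((1 - ‖t‖) * ‖t‖) := by
    have := congrArg norm h2
    rwa [norm_smul, norm_smul, norm_smul, Real.norm_of_nonneg (by linarith),
      Real.norm_of_nonneg hc.le, Real.norm_of_nonneg (by linarith)] at this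
  have hs0 := norm_nonneg s
  have ht0 := norm_nonneg t
  have h4 : ‖s‖ = ‖t‖ := by
    -- Eliminating between the equations for the head and for the norm of the tail. The last factor
    -- could vanish only for `‖s‖ = 0`, `‖t‖ = 1`, and there the heads 1 and -1 have opposite signs,
    -- against `c > 0`.
    have h5 : c * ((‖t‖ - ‖s‖) * ((1 - ‖s‖) * (1 - ‖t‖) + ‖s‖ * ‖t‖)) = 0 := by
      linear_combination ((1 - ‖s‖) * ‖s‖) * h1 - (1 - 2 * ‖s‖) * h3
    have h6 : 0 < (1 - ‖s‖) * (1 - ‖t‖) + ‖s‖ * ‖t‖ := by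
      rcases ht.lt_or_eq with ht' | ht'
      · have := mul_pos (sub_pos.mpr hs) (sub_pos.mpr ht')
        positivity
      · rw [ht'] at h3 ⊢
        rcases hs0.lt_or_eq with hs' | hs'
        · linarith
        · rw [ht', ← hs'] at h1
          linarith
    have h7 := (mul_eq_zero.mp ((mul_eq_zero.mp h5).resolve_left hc.ne')).resolve_right h6.ne'
    linarith
  rcases hs0.eq_or_lt with hs' | hs'
  · rw [norm_eq_zero.mp hs'.symm, norm_eq_zero.mp (h4.symm.trans hs'.symm)]
  · have h8 : 0 < (1 - ‖s‖) * ‖s‖ := mul_pos (sub_pos.mpr hs) hs'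
    have h9 : c = 1 := by
      rw [← h4] at h3
      exact mul_right_cancel₀ h8.ne' (by linarith)
    rw [h9, one_smul, ← h4] at h2
    exact smul_right_injective _ (sub_pos.mpr hs).ne' h2

theorem exists_wrap_eq {u : Fin (n + 1) → ℝ} (hu : ‖u‖ = 1) (hp : u ≠ pole n) :
    ∃ s : Fin n → ℝ, ‖s‖ < 1 ∧ wrap s = u := by
  obtain ⟨c, v, rfl⟩ : ∃ c v, u = Fin.cons c v := ⟨u 0, Fin.tail u, (Fin.cons_self_tail u).symm⟩
  have hm := hu
  rw [norm_cons] at hm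
  by_cases hv : v = 0
  · subst hv
    rw [norm_zero, max_eq_left (abs_nonneg c)] at hm
    have hc : c = 1 := by
      rcases (abs_eq zero_le_one).mp hm with h | h
      · exact h
      · exact absurd (by rw [pole, h]) hp
    subst hc
    refine ⟨0, by simp, wrap_eq_of_wrapVec_eq one_pos hu ?_⟩
    simp [wrapVec]
  · have hv' := norm_pos_iff.mpr hv
    -- The preimage is sought as the multiple of `v` of norm `r`. Proportionality of `wrapVec` to
    -- `(c, v)` is then the vanishing of this function, whose values at 0 and 1 are `‖v‖` and
    -- `-‖v‖`.
    have hcont : ContinuousOn (fun r : ℝ => (1 - 2 * r) * ‖v‖ - c * ((1 - r) * r)) (Icc 0 1) := by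
      fun_prop
    obtain ⟨r, hr, hr'⟩ := intermediate_value_Ioo' zero_le_one hcont
      (show (0 : ℝ) ∈ Ioo _ _ by norm_num [hv'])
    have hr0 : 0 < r := hr.1
    have hr1 : r < 1 := hr.2
    have hns : ‖(r * ‖v‖⁻¹) • v‖ = r := by
      rw [norm_smul, Real.norm_of_nonneg (by positivity), mul_assoc, inv_mul_cancel₀ hv'.ne',
        mul_one]
    refine ⟨(r * ‖v‖⁻¹) • v, hns.trans_lt hr1,
      wrap_eq_of_wrapVec_eq (c := (1 - r) * r * ‖v‖⁻¹) ?_ hu ?_⟩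
    · have : 0 < 1 - r := by linarith
      positivity
    · rw [wrapVec, hns, smul_cons, smul_smul, mul_assoc]
      have h1 : (1 - 2 * r) = (1 - r) * r * ‖v‖⁻¹ * c := by
        have h2 : (1 - 2 * r) * ‖v‖ = c * ((1 - r) * r) := sub_eq_zero.mp hr'
        field_simp
        linarith
      rw [h1]
      simp only [mul_assoc]

/-- Polar coordinates on a shell. -/
noncomputable def shellMap (x : Fin (n + 1) → ℝ) : Fin (n + 1) → ℝ :=
  ((3 + x 0) / 4) • wrap (Fin.tail x)

theorem continuous_shellMap : Continuous (shellMap : (Fin (n + 1) → ℝ) → Fin (n + 1) → ℝ) := by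
  have h : Continuous (Fin.tail : (Fin (n + 1) → ℝ) → Fin n → ℝ) :=
    continuous_pi fun j => continuous_apply j.succ
  exact ((continuous_const.add (continuous_apply 0)).div_const 4).smul (continuous_wrap.comp h)

theorem norm_shellMap {x : Fin (n + 1) → ℝ} (hx : ‖x‖ ≤ 1) : ‖shellMap x‖ = (3 + x 0) / 4 := by
  have h := (abs_le.mp ((norm_le_pi_norm x 0).trans hx)).1
  rw [shellMap, norm_smul, norm_wrap, mul_one, Real.norm_of_nonneg (by linarith)]

theorem shellMap_injOn : InjOn (shellMap : (Fin (n + 1) → ℝ) → Fin (n + 1) → ℝ) (ball 0 1) := by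
  intro x hx y hy h
  rw [mem_ball_zero_iff] at hx hy
  have h1 := congrArg norm h
  rw [norm_shellMap hx.le, norm_shellMap hy.le] at h1
  have h2 : x 0 = y 0 := by linarith
  have h3 := (abs_le.mp ((norm_le_pi_norm x 0).trans hx.le)).1
  rw [shellMap, shellMap, h2] at h
  have h4 := smul_right_injective _ (r := (3 + y 0) / 4) (by linarith) h
  rw [norm_eq_max_tail, max_lt_iff] at hx hy
  rw [← Fin.cons_self_tail x, ← Fin.cons_self_tail y, h2, wrap_injective hx.2 hy.2.le h4]

/-- The equation `w = ‖w‖ • pole n` says that `w` lies on the ray through the pole. Off the unit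
sphere, a vanishing tail of `wrapVec s` forces `s = 0`, where the head is 1 and points away from the
pole. -/
theorem smul_wrap_eq_iff {s : Fin n → ℝ} {r : ℝ} (hr : 0 < r) :
    r • wrap s = ‖r • wrap s‖ • pole n ↔ ‖s‖ = 1 := by
  rw [norm_smul, norm_wrap, mul_one, Real.norm_of_nonneg hr.le]
  constructor
  · intro h
    have h1 : wrap s = pole n := smul_right_injective _ hr.ne' h
    by_contra h2
    have h3 : wrapVec s = ‖wrapVec s‖ • pole n := by
      rw [← h1, wrap, smul_smul, mul_inv_cancel₀ (norm_ne_zero_iff.mpr (wrapVec_ne_zero s)),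
        one_smul]
    rw [pole, smul_cons, smul_zero] at h3
    obtain ⟨h4, h5⟩ := cons_eq_cons h3
    have h6 : s = 0 := (smul_eq_zero.mp h5).resolve_left (sub_ne_zero.mpr (Ne.symm h2))
    have h7 : ‖s‖ = 0 := by rw [h6, norm_zero]
    have h8 := norm_nonneg (wrapVec s)
    rw [h7] at h4
    linarith
  · intro h
    rw [wrap_eq_pole h]

/-- The first coordinate runs through the radii from 1/2 to 1 and the others through the sphere
without its pole, so the open cube covers the open shell cut along the ray through the pole. -/
theorem image_shellMap : shellMap '' ball (0 : Fin (n + 1) → ℝ) 1 =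
    {w | 1 / 2 < ‖w‖ ∧ ‖w‖ < 1 ∧ w ≠ ‖w‖ • pole n} := by
  ext w
  constructor
  · rintro ⟨x, hx, rfl⟩
    rw [mem_ball_zero_iff] at hx
    have hx' := hx
    rw [norm_eq_max_tail, max_lt_iff, abs_lt] at hx'
    refine ⟨?_, ?_, fun h => ?_⟩
    · rw [norm_shellMap hx.le]
      linarith
    · rw [norm_shellMap hx.le]
      linarith
    · exact hx'.2.ne ((smul_wrap_eq_iff (by linarith)).mp h)
  · rintro ⟨h1, h2, h3⟩
    have h0 : 0 < ‖w‖ := by linarith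
    obtain ⟨s, hs, hs'⟩ := exists_wrap_eq (u := ‖w‖⁻¹ • w)
      (by rw [norm_smul, norm_inv, norm_norm, inv_mul_cancel₀ h0.ne'])
      (fun h => h3 (by rw [← h, smul_smul, mul_inv_cancel₀ h0.ne', one_smul]))
    refine ⟨Fin.cons (4 * ‖w‖ - 3) s, ?_, ?_⟩
    · rw [mem_ball_zero_iff, norm_cons, max_lt_iff, abs_lt]
      exact ⟨⟨by linarith, by linarith⟩, hs⟩
    · rw [shellMap, Fin.tail_cons, Fin.cons_zero, hs', smul_smul,
        show (3 + (4 * ‖w‖ - 3)) / 4 * ‖w‖⁻¹ = 1 by field_simp; ring, one_smul]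

theorem image_half_wrap : (fun s : Fin n → ℝ => (1 / 2 : ℝ) • wrap s) '' ball 0 1 =
    {w | ‖w‖ = 1 / 2 ∧ w ≠ ‖w‖ • pole n} := by
  ext w
  constructor
  · rintro ⟨s, hs, rfl⟩
    rw [mem_ball_zero_iff] at hs
    refine ⟨?_, fun h => hs.ne ((smul_wrap_eq_iff (by norm_num)).mp h)⟩
    rw [norm_smul, norm_wrap]
    norm_num
  · rintro ⟨h1, h3⟩
    have h0 : 0 < ‖w‖ := by rw [h1]; norm_num
    obtain ⟨s, hs, hs'⟩ := exists_wrap_eq (u := ‖w‖⁻¹ • w)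
      (by rw [norm_smul, norm_inv, norm_norm, inv_mul_cancel₀ h0.ne'])
      (fun h => h3 (by rw [← h, smul_smul, mul_inv_cancel₀ h0.ne', one_smul]))
    refine ⟨s, mem_ball_zero_iff.mpr hs, ?_⟩
    change (1 / 2 : ℝ) • wrap s = w
    rw [hs', smul_smul, ← h1, mul_inv_cancel₀ h0.ne', one_smul]

theorem half_wrap_injOn : InjOn (fun s : Fin n → ℝ => (1 / 2 : ℝ) • wrap s) (ball 0 1) := by
  intro s hs t ht h
  rw [mem_ball_zero_iff] at hs ht
  exact wrap_injective hs ht.le (smul_right_injective _ (by norm_num) h)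

theorem image_edge : (fun t : Fin 1 → ℝ => ((3 + t 0) / 4) • pole n) '' ball 0 1 =
    {w | 1 / 2 < ‖w‖ ∧ ‖w‖ < 1 ∧ w = ‖w‖ • pole n} := by
  ext w
  constructor
  · rintro ⟨t, ht, rfl⟩
    rw [mem_ball_zero_iff, norm_eq_max_tail, max_lt_iff, abs_lt] at ht
    have h : ‖((3 + t 0) / 4) • pole n‖ = (3 + t 0) / 4 := by
      rw [norm_smul, norm_pole, mul_one, Real.norm_of_nonneg (by linarith)]
    refine ⟨?_, ?_, by rw [h]⟩ <;> rw [h] <;> linarith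
  · rintro ⟨h1, h2, h3⟩
    refine ⟨fun _ => 4 * ‖w‖ - 3, ?_, ?_⟩
    · rw [mem_ball_zero_iff, pi_norm_const, Real.norm_eq_abs, abs_lt]
      constructor <;> linarith
    · change ((3 + (4 * ‖w‖ - 3)) / 4) • pole n = w
      rw [show (3 + (4 * ‖w‖ - 3)) / 4 = ‖w‖ by ring]
      exact h3.symm

theorem edge_injOn : InjOn (fun t : Fin 1 → ℝ => ((3 + t 0) / 4) • pole n) (ball 0 1) := by
  intro s _ t _ h
  have h1 : (3 + s 0) / 4 = (3 + t 0) / 4 :=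
    smul_left_injective ℝ (norm_ne_zero_iff.mp (by rw [norm_pole]; exact one_ne_zero)) h
  funext i
  rw [Subsingleton.elim i 0]
  linarith

theorem image_half : (fun w : Fin n → ℝ => (1 / 2 : ℝ) • w) '' ball 0 1 = ball 0 (1 / 2) := by
  rw [image_smul, smul_unitBall (by norm_num), Real.norm_of_nonneg (by norm_num)]
end Cubes
end HigherTwist

/-! ### Subdividing a cell of a cell structure -/

namespace HigherTwist

open Set Metric

namespace CellStructure

variable {Y : Type} [TopologicalSpace Y] {n : ℕ} {Φ : (Fin (n + 1) → ℝ) → Y}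

/-- One step of the subdivision: `R` is the region of the open cube already covered by new cells and
`ψ` parametrizes the next piece `R'`. Since `Φ` is injective on the open cube and avoids `A` there,
disjointness of regions gives disjointness of cells. -/
theorem exists_isAttached {D : CellStructure Y} {A : Set Y} {R R' : Set (Fin (n + 1) → ℝ)} {m : ℕ}
    {ψ : (Fin m → ℝ) → Fin (n + 1) → ℝ} (hc : ContinuousOn Φ (closedBall 0 1))
    (hi : InjOn Φ (ball 0 1)) (hd : ∀ x ∈ ball 0 1, Φ x ∉ A)
    (hD : D.carrier = A ∪ Φ '' R) (hR : R ⊆ ball 0 1) (hR' : R' ⊆ ball 0 1) (hRR' : Disjoint R R')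
    (hψ : Continuous ψ) (hψm : ∀ x, ‖x‖ ≤ 1 → ‖ψ x‖ ≤ 1) (hψi : InjOn ψ (ball 0 1))
    (hψR : ψ '' ball 0 1 = R') (hf : ∀ x, ‖x‖ = 1 → Φ (ψ x) ∈ D.skel m) :
    ∃ D' : CellStructure Y, IsAttached D D' m (Φ '' R') ∧ D'.carrier = A ∪ Φ '' (R ∪ R') := by
  have hmem : ∀ x ∈ ball (0 : Fin m → ℝ) 1, ψ x ∈ R' := fun x hx => hψR ▸ mem_image_of_mem ψ hx
  have h := D.isAttached_attach (Φ ∘ ψ)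
    (hc.comp hψ.continuousOn fun x hx => by
      rw [mem_closedBall_zero_iff] at hx ⊢
      exact hψm x hx)
    (hi.comp hψi fun x hx => hR' (hmem x hx))
    (fun x hx => by
      rw [hD]
      rintro (h | ⟨z, hz, hz'⟩)
      · exact hd _ (hR' (hmem x hx)) h
      · have := hi (hR hz) (hR' (hmem x hx)) hz'
        exact hRR'.notMem_of_mem_left hz (this ▸ hmem x hx))
    (fun x hx => hf x (mem_sphere_zero_iff_norm.mp hx))
  rw [image_comp, hψR] at h
  refine ⟨_, h, ?_⟩
  rw [h.carrier_eq, hD, image_union, union_assoc]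

/-- The point, the punctured sphere and the punctured shell that subdivide a cube, as sets. -/
theorem half_pole_region : {w : Fin (n + 1) → ℝ | ‖w‖ = 1 / 2 ∧ w = ‖w‖ • pole n} =
    {(1 / 2 : ℝ) • pole n} := by
  ext w
  constructor
  · rintro ⟨h, h'⟩
    rw [h] at h'
    exact h'
  · rintro rfl
    have h : ‖(1 / 2 : ℝ) • pole n‖ = 1 / 2 := by
      rw [norm_smul, norm_pole]
      norm_num
    exact ⟨h, by rw [h]⟩

theorem sphere_region : {w : Fin (n + 1) → ℝ | ‖w‖ = 1 / 2 ∧ w = ‖w‖ • pole n} ∪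
    {w | ‖w‖ = 1 / 2 ∧ w ≠ ‖w‖ • pole n} = sphere 0 (1 / 2) := by
  ext w
  rw [mem_sphere_zero_iff_norm]
  change (_ ∧ _) ∨ (_ ∧ _) ↔ _
  tauto

/-- The union of a vertex and an open cell that covers a sphere inside a cell. -/
theorem exists_isAttached_sphere {D : CellStructure Y} {A : Set Y}
    (hc : ContinuousOn Φ (closedBall 0 1)) (hi : InjOn Φ (ball 0 1))
    (hd : ∀ x ∈ ball 0 1, Φ x ∉ A) (hD : D.carrier = A) :
    ∃ D₁ D₂ : CellStructure Y, IsAttached D D₁ 0 (Φ '' {(1 / 2 : ℝ) • pole n}) ∧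
      IsAttached D₁ D₂ n (Φ '' {w | ‖w‖ = 1 / 2 ∧ w ≠ ‖w‖ • pole n}) ∧
      D₂.carrier = A ∪ Φ '' sphere 0 (1 / 2) := by
  have hp : (1 / 2 : ℝ) • pole n ∈ ball (0 : Fin (n + 1) → ℝ) 1 := by
    rw [mem_ball_zero_iff, norm_smul, norm_pole]
    norm_num
  have himg : (fun _ : Fin 0 → ℝ => (1 / 2 : ℝ) • pole n) '' ball 0 1 = {(1 / 2 : ℝ) • pole n} :=
    Nonempty.image_const ⟨0, by simp⟩ _
  obtain ⟨D₁, h₁, hD₁⟩ := exists_isAttached (D := D) (A := A) (R := ∅) hc hi hd (by simp [hD])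
    (empty_subset _) (singleton_subset_iff.mpr hp) (empty_disjoint _) continuous_const
    (fun _ _ => (mem_ball_zero_iff.mp hp).le) (fun x _ y _ _ => Subsingleton.elim x y) himg
    (fun x hx => by
      rw [Subsingleton.elim x 0, norm_zero] at hx
      exact absurd hx zero_ne_one)
  rw [empty_union] at hD₁
  obtain ⟨D₂, h₂, hD₂⟩ := exists_isAttached (D := D₁) (A := A) hc hi hd hD₁
    (singleton_subset_iff.mpr hp)
    (R' := {w | ‖w‖ = 1 / 2 ∧ w ≠ ‖w‖ • pole n})
    (fun w hw => by
      rw [mem_ball_zero_iff, hw.1]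
      norm_num)
    (by
      rw [← half_pole_region, disjoint_left]
      exact fun w hw hw' => hw'.2 hw.2)
    (ψ := fun s => (1 / 2 : ℝ) • wrap s) ((continuous_const_smul (1 / 2 : ℝ)).comp continuous_wrap)
    (fun x _ => by
      rw [norm_smul, norm_wrap]
      norm_num)
    half_wrap_injOn image_half_wrap
    (fun x hx => by
      -- For `n = 0` the unit sphere is empty. Otherwise `wrap` sends the whole boundary to the
      -- vertex, whose dimension 0 is less than `n`.
      have hn : n ≠ 0 := by
        rintro rfl
        rw [Subsingleton.elim x 0, norm_zero] at hx
        exact zero_ne_one hx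
      rw [wrap_eq_pole hx]
      exact h₁.cell_subset n (Nat.pos_of_ne_zero hn) ⟨_, rfl, rfl⟩)
  refine ⟨D₁, D₂, h₁, h₂, ?_⟩
  rw [hD₂, ← half_pole_region, sphere_region]

/-- The vertex and the `n`-cell attached to the empty structure. The dimension bound is what lets
induction on dimension treat the intersection of the two halves of a cell. -/
theorem exists_sphere (hc : ContinuousOn Φ (closedBall 0 1)) (hi : InjOn Φ (ball 0 1)) :
    ∃ D : CellStructure Y, D.carrier = Φ '' sphere 0 (1 / 2) ∧ ∀ i, D.dim i < n + 1 := by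
  obtain ⟨D₁, D₂, h₁, h₂, h⟩ := exists_isAttached_sphere (D := empty Y) (A := ∅) hc hi
    (fun _ _ => notMem_empty _) carrier_empty
  rw [empty_union] at h
  exact ⟨D₂, h, h₂.dim_lt _ (h₁.dim_lt _ (fun i => i.elim) n.succ_pos) n.lt_succ_self⟩

/-- The subdivision of a cell into a cube, its boundary sphere and the surrounding shell. -/
theorem exists_subdivision {A : CellStructure Y} (hc : ContinuousOn Φ (closedBall 0 1))
    (hi : InjOn Φ (ball 0 1)) (hd : ∀ x ∈ ball 0 1, Φ x ∉ A.carrier)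
    (hf : ∀ x ∈ sphere 0 1, Φ x ∈ A.skel (n + 1)) (hv : Φ (pole n) ∈ A.skel 1) :
    ∃ D : CellStructure Y, D.carrier = A.carrier ∪ Φ '' ball 0 1 ∧
      (∀ k, A.skel k ⊆ D.skel k) ∧ (∀ k, n + 1 < k → Φ '' ball 0 1 ⊆ D.skel k) ∧
      Φ ((1 / 2 : ℝ) • pole n) ∈ D.skel 1 ∧
      D.IsUnion (A.carrier ∪ Φ '' (closedBall 0 1 \ ball 0 (1 / 2))) ∧
      D.IsUnion (Φ '' closedBall 0 (1 / 2)) := by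
  obtain ⟨D₁, D₂, h₁, h₂, hD₂⟩ := exists_isAttached_sphere (D := A) hc hi hd rfl
  have hq : ∀ k, 0 < k → Φ ((1 / 2 : ℝ) • pole n) ∈ D₂.skel k := fun k hk =>
    h₂.skel_subset k (h₁.cell_subset k hk ⟨_, rfl, rfl⟩)
  have hhalf : sphere (0 : Fin (n + 1) → ℝ) (1 / 2) ⊆ ball 0 1 := by
    intro w hw
    rw [mem_sphere_zero_iff_norm] at hw
    rw [mem_ball_zero_iff, hw]
    norm_num
  -- The inner sphere consists of cells of dimensions 0 and `n`, so it is an admissible frontier for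
  -- the two `(n + 1)`-cells on its sides.
  have hS : ∀ w : Fin (n + 1) → ℝ, ‖w‖ = 1 / 2 → Φ w ∈ D₂.skel (n + 1) := by
    intro w hw
    by_cases hw' : w = ‖w‖ • pole n
    · rw [hw'] at hw ⊢
      rw [norm_smul, norm_pole, mul_one, norm_norm] at hw
      rw [hw]
      exact hq _ n.succ_pos
    · exact h₂.cell_subset _ n.lt_succ_self ⟨w, ⟨hw, hw'⟩, rfl⟩
  -- The edge along the ray of the pole; its outer end is the vertex provided by `hv`.
  obtain ⟨D₃, h₃, hD₃⟩ := exists_isAttached (D := D₂) hc hi hd hD₂ hhalf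
    (R' := {w | 1 / 2 < ‖w‖ ∧ ‖w‖ < 1 ∧ w = ‖w‖ • pole n})
    (ψ := fun t : Fin 1 → ℝ => ((3 + t 0) / 4) • pole n)
    (fun w hw => mem_ball_zero_iff.mpr hw.2.1)
    (by
      rw [disjoint_left]
      intro w hw hw'
      rw [mem_sphere_zero_iff_norm] at hw
      exact hw'.1.ne' hw)
    (by fun_prop)
    (fun t ht => by
      have h := abs_le.mp ((norm_le_pi_norm t 0).trans ht)
      rw [norm_smul, norm_pole, mul_one, Real.norm_of_nonneg (by linarith)]
      linarith)
    edge_injOn image_edge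
    (fun t ht => by
      rw [norm_eq_max_tail, Subsingleton.elim (Fin.tail t) 0, norm_zero,
        max_eq_left (abs_nonneg _)] at ht
      rcases (abs_eq zero_le_one).mp ht with h | h
      · rw [h]
        norm_num
        exact h₂.skel_subset 1 (h₁.skel_subset 1 hv)
      · rw [h]
        have := hq 1 one_pos
        norm_num at this ⊢
        exact this)
  -- For `n = 0` the edge itself has dimension `n + 1` and is not in this skeleton. No harm results:
  -- the cube of the shell then has no side faces that would be mapped to the edge.
  have hE : ∀ r : ℝ, 1 / 2 ≤ r → r ≤ 1 → 1 < n + 1 → Φ (r • pole n) ∈ D₃.skel (n + 1) := by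
    intro r hr hr' hn
    rcases hr.eq_or_lt with rfl | hr
    · exact h₃.skel_subset _ (hq _ n.succ_pos)
    rcases hr'.eq_or_lt with rfl | hr'
    · rw [one_smul]
      exact h₃.skel_subset _ (h₂.skel_subset _ (h₁.skel_subset _ (A.skel_mono n.succ_pos hv)))
    · have h : ‖r • pole n‖ = r := by
        rw [norm_smul, norm_pole, mul_one, Real.norm_of_nonneg (by linarith)]
      refine h₃.cell_subset _ hn ⟨r • pole n, ⟨?_, ?_, ?_⟩, rfl⟩ <;> rw [h] <;> assumption
  obtain ⟨D₄, h₄, hD₄⟩ := exists_isAttached (D := D₃) hc hi hd hD₃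
    (union_subset hhalf fun w hw => mem_ball_zero_iff.mpr hw.2.1)
    (R' := {w | 1 / 2 < ‖w‖ ∧ ‖w‖ < 1 ∧ w ≠ ‖w‖ • pole n})
    (fun w hw => mem_ball_zero_iff.mpr hw.2.1)
    (by
      rw [disjoint_left]
      rintro w (hw | hw) hw'
      · rw [mem_sphere_zero_iff_norm] at hw
        exact hw'.1.ne' hw
      · exact hw'.2.2 hw.2.2)
    continuous_shellMap
    (fun x hx => by
      have h := abs_le.mp ((norm_le_pi_norm x 0).trans hx)
      rw [norm_shellMap hx]
      linarith)
    shellMap_injOn image_shellMap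
    (fun x hx => by
      have h := abs_le.mp ((norm_le_pi_norm x 0).trans hx.le)
      have hx' := hx
      rw [norm_eq_max_tail] at hx'
      -- The boundary of the cube of the shell: side faces are collapsed to the edge, the face `x 0
      -- = 1` goes to the outer boundary, and `x 0 = -1` to the inner sphere.
      by_cases ht : ‖Fin.tail x‖ = 1
      · have hn : 1 < n + 1 := by
          rcases Nat.eq_zero_or_pos n with rfl | hn
          · rw [Subsingleton.elim (Fin.tail x) 0, norm_zero] at ht
            exact absurd ht zero_ne_one
          · omega
        rw [shellMap, wrap_eq_pole ht]
        exact hE _ (by linarith) (by linarith) hn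
      · have h0 : |x 0| = 1 := by
          rcases max_choice |x 0| ‖Fin.tail x‖ with h' | h'
          · rw [← h', hx']
          · exact absurd (h'.symm.trans hx') ht
        have hs := norm_shellMap hx.le
        rcases (abs_eq zero_le_one).mp h0 with h' | h'
        · refine h₃.skel_subset _ (h₂.skel_subset _ (h₁.skel_subset _ (hf _ ?_)))
          rw [mem_sphere_zero_iff_norm, hs, h']
          norm_num
        · refine h₃.skel_subset _ (hS _ ?_)
          rw [hs, h']
          norm_num)
  obtain ⟨D₅, h₅, hD₅⟩ := exists_isAttached (D := D₄) hc hi hd hD₄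
    (union_subset (union_subset hhalf fun w hw => mem_ball_zero_iff.mpr hw.2.1)
      fun w hw => mem_ball_zero_iff.mpr hw.2.1)
    (R' := ball 0 (1 / 2)) (ball_subset_ball (by norm_num))
    (by
      rw [disjoint_right]
      intro w hw
      rw [mem_ball_zero_iff] at hw
      rintro ((hw' | hw') | hw')
      · rw [mem_sphere_zero_iff_norm] at hw'
        exact hw.ne hw'
      · exact hw.not_gt hw'.1
      · exact hw.not_gt hw'.1)
    (continuous_const_smul (1 / 2 : ℝ))
    (fun x hx => by
      rw [norm_smul, Real.norm_of_nonneg (by norm_num)]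
      linarith)
    (smul_right_injective _ (by norm_num)).injOn image_half
    (fun x hx => h₄.skel_subset _ (h₃.skel_subset _ (hS _ (by
      rw [norm_smul, hx]
      norm_num))))
  have hshell : sphere (0 : Fin (n + 1) → ℝ) (1 / 2) ∪
      {w | 1 / 2 < ‖w‖ ∧ ‖w‖ < 1 ∧ w = ‖w‖ • pole n} ∪
      {w | 1 / 2 < ‖w‖ ∧ ‖w‖ < 1 ∧ w ≠ ‖w‖ • pole n} = ball 0 1 \ ball 0 (1 / 2) := by
    ext w
    rw [mem_sdiff, mem_ball_zero_iff, mem_ball_zero_iff, not_lt, le_iff_eq_or_lt,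
      eq_comm (a := 1 / 2), mem_union, mem_union, mem_sphere_zero_iff_norm]
    change (_ ∨ (_ ∧ _ ∧ _)) ∨ (_ ∧ _ ∧ _) ↔ _
    by_cases hw' : w = ‖w‖ • pole n
    · have h1 : ‖w‖ = 1 / 2 → ‖w‖ < 1 := fun h => by rw [h]; norm_num
      tauto
    · have h1 : ‖w‖ = 1 / 2 → ‖w‖ < 1 := fun h => by rw [h]; norm_num
      tauto
  have hball : ball (0 : Fin (n + 1) → ℝ) 1 \ ball 0 (1 / 2) ∪ ball 0 (1 / 2) = ball 0 1 :=
    sdiff_union_of_subset (ball_subset_ball (by norm_num))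
  have hD₅' : D₅.carrier = A.carrier ∪ Φ '' ball 0 1 := by rw [hD₅, hshell, hball]
  refine ⟨D₅, hD₅', fun k => (h₁.skel_subset k).trans ((h₂.skel_subset k).trans
    ((h₃.skel_subset k).trans ((h₄.skel_subset k).trans (h₅.skel_subset k)))), fun k hk => ?_,
    h₅.skel_subset _ (h₄.skel_subset _ (h₃.skel_subset _ (hq 1 one_pos))), ?_, ?_⟩
  · rw [← hball, ← hshell]
    rintro _ ⟨w, ((hw | hw) | hw) | hw, rfl⟩
    · refine h₅.skel_subset _ (h₄.skel_subset _ (h₃.skel_subset _ (D₂.skel_mono hk.le (hS w ?_))))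
      exact mem_sphere_zero_iff_norm.mp hw
    · exact h₅.skel_subset _ (h₄.skel_subset _ (h₃.cell_subset k (by omega) ⟨w, hw, rfl⟩))
    · exact h₅.skel_subset _ (h₄.cell_subset k hk ⟨w, hw, rfl⟩)
    · exact h₅.cell_subset k hk ⟨w, hw, rfl⟩
  -- The outer boundary is mapped into `A`, so closing the shell adds nothing to the structure
  -- before the inner cube was attached.
  · have h : A.carrier ∪ Φ '' (closedBall 0 1 \ ball 0 (1 / 2)) = D₄.carrier := by
      rw [hD₄, hshell]
      refine subset_antisymm ?_ (union_subset_union_right _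
        (image_mono (sdiff_subset_sdiff_left ball_subset_closedBall)))
      refine union_subset subset_union_left ?_
      rintro _ ⟨w, ⟨hw, hw'⟩, rfl⟩
      rw [← ball_union_sphere] at hw
      rcases hw with hw | hw
      · exact Or.inr ⟨w, ⟨hw, hw'⟩, rfl⟩
      · exact Or.inl (A.skel_subset_carrier _ (hf w hw))
    rw [h]
    exact h₅.isUnion _ D₄.isUnion_carrier
  · have h : Φ '' closedBall 0 (1 / 2) = Φ '' {(1 / 2 : ℝ) • pole n} ∪
        Φ '' {w | ‖w‖ = 1 / 2 ∧ w ≠ ‖w‖ • pole n} ∪ Φ '' ball 0 (1 / 2) := by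
      rw [← image_union, ← image_union, ← half_pole_region, sphere_region, sphere_union_ball]
    rw [h]
    exact ((h₅.isUnion _ (h₄.isUnion _ (h₃.isUnion _ (h₂.isUnion _ h₁.isUnion_cell)))).union
      (h₅.isUnion _ (h₄.isUnion _ (h₃.isUnion _ h₂.isUnion_cell)))).union h₅.isUnion_cell

end CellStructure

end HigherTwist

/-! ### Making a given point a vertex -/

namespace HigherTwist

open Set Metric

/-- Homeomorphisms that move the centre of a cube and fix its boundary. -/
theorem exists_homeomorph_cube {n : ℕ} {z : Fin (n + 1) → ℝ} (hz : ‖z‖ < 1) :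
    ∃ e : (Fin (n + 1) → ℝ) ≃ₜ (Fin (n + 1) → ℝ), (∀ w, ‖e w‖ < 1 ↔ ‖w‖ < 1) ∧
      (∀ w, ‖w‖ = 1 → e w = w) ∧ e 0 = z := by
  -- The map `w ↦ w + (1 - ‖w‖) • z` differs from the identity by a Lipschitz map of constant `‖z‖ <
  -- 1`, hence is a homeomorphism of the whole space.
  have happ : ApproximatesLinearOn (fun w : Fin (n + 1) → ℝ => w + (1 - ‖w‖) • z)
      (ContinuousLinearEquiv.refl ℝ (Fin (n + 1) → ℝ) : (Fin (n + 1) → ℝ) →L[ℝ] _) univ ‖z‖₊ := by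
    intro x _ y _
    have h : x + (1 - ‖x‖) • z - (y + (1 - ‖y‖) • z) - (x - y) = (‖y‖ - ‖x‖) • z := by
      module
    change ‖x + (1 - ‖x‖) • z - (y + (1 - ‖y‖) • z) - (x - y)‖ ≤ ‖z‖ * ‖x - y‖
    rw [h, norm_smul, mul_comm]
    refine mul_le_mul_of_nonneg_left ?_ (norm_nonneg z)
    rw [norm_sub_rev x y]
    exact abs_norm_sub_norm_le y x
  have hc : ‖z‖₊ < ‖((ContinuousLinearEquiv.refl ℝ (Fin (n + 1) → ℝ)).symm :
      (Fin (n + 1) → ℝ) →L[ℝ] (Fin (n + 1) → ℝ))‖₊⁻¹ := by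
    have h : ‖((ContinuousLinearEquiv.refl ℝ (Fin (n + 1) → ℝ)).symm :
      (Fin (n + 1) → ℝ) →L[ℝ] (Fin (n + 1) → ℝ))‖₊ = 1 :=
      NNReal.eq (ContinuousLinearMap.norm_id (𝕜 := ℝ))
    rw [h, inv_one]
    exact hz
  refine ⟨happ.toHomeomorph _ (Or.inr hc), fun w => ?_, fun w hw => ?_, ?_⟩
  · change ‖w + (1 - ‖w‖) • z‖ < 1 ↔ _
    constructor
    · intro h
      by_contra! hw
      have h1 := norm_sub_norm_le w (-((1 - ‖w‖) • z))
      rw [sub_neg_eq_add, norm_neg, norm_smul, Real.norm_of_nonpos (by linarith)] at h1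
      nlinarith [norm_nonneg z]
    · intro hw
      have h1 := norm_add_le w ((1 - ‖w‖) • z)
      rw [norm_smul, Real.norm_of_nonneg (by linarith)] at h1
      nlinarith [norm_nonneg z]
  · change w + (1 - ‖w‖) • z = w
    rw [hw]
    simp
  · change (0 : Fin (n + 1) → ℝ) + (1 - ‖(0 : Fin (n + 1) → ℝ)‖) • z = z
    simp

/-- Move `x` to the centre and the centre to `z`. As the boundary stays fixed pointwise,
precomposing a characteristic map with such a homeomorphism does not affect how the cell is
attached. -/
theorem exists_homeomorph_cube_apply_eq {n : ℕ} {x z : Fin (n + 1) → ℝ} (hx : ‖x‖ < 1)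
    (hz : ‖z‖ < 1) :
    ∃ e : (Fin (n + 1) → ℝ) ≃ₜ (Fin (n + 1) → ℝ), (∀ w, ‖e w‖ < 1 ↔ ‖w‖ < 1) ∧
      (∀ w, ‖w‖ = 1 → e w = w) ∧ e x = z := by
  obtain ⟨e, h1, h2, h3⟩ := exists_homeomorph_cube hx
  obtain ⟨e', h1', h2', h3'⟩ := exists_homeomorph_cube hz
  refine ⟨e.symm.trans e', fun w => ?_, fun w hw => ?_, ?_⟩
  · change ‖e' (e.symm w)‖ < 1 ↔ _
    rw [h1', ← h1, e.apply_symm_apply]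
  · change e' (e.symm w) = w
    rw [e.symm_apply_eq.mpr (h2 w hw).symm, h2' w hw]
  · change e' (e.symm x) = z
    rw [e.symm_apply_eq.mpr h3.symm, h3']

/-- A continuous map from a compact set to a Hausdorff space is closed, hence a quotient map onto
its image. Maps defined on a cube thereby descend to the closed cell. -/
theorem continuousOn_image_of_isCompact {α β γ : Type*} [TopologicalSpace α] [TopologicalSpace β]
    [TopologicalSpace γ] [T2Space β] {q : α → β} {g : β → γ} {s : Set α} (hs : IsCompact s)
    (hq : ContinuousOn q s) (hg : ContinuousOn (g ∘ q) s) : ContinuousOn g (q '' s) := by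
  rw [continuousOn_iff_isClosed] at hg ⊢
  intro t ht
  obtain ⟨u, hu, hut⟩ := hg t ht
  refine ⟨q '' (s ∩ u), ((hs.inter_right hu).image_of_continuousOn
    (hq.mono inter_subset_left)).isClosed, ?_⟩
  ext y
  constructor
  · rintro ⟨hy, x, hx, rfl⟩
    have h : x ∈ u ∩ s := hut ▸ ⟨hy, hx⟩
    exact ⟨⟨x, ⟨hx, h.1⟩, rfl⟩, x, hx, rfl⟩
  · rintro ⟨⟨x, ⟨hx, hx'⟩, rfl⟩, -⟩
    have h : x ∈ (g ∘ q) ⁻¹' t ∩ s := hut ▸ ⟨hx', hx⟩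
    exact ⟨h.1, x, hx, rfl⟩

namespace CellStructure

variable {Y : Type} [TopologicalSpace Y]

/-- Frees the dimension from the index, so that a positive dimension can be written as `n + 1` in
the type of the cube. -/
theorem exists_charMap (D : CellStructure Y) {i : D.ι} {m : ℕ} (h : D.dim i = m) :
    ∃ Φ : (Fin m → ℝ) → Y, ContinuousOn Φ (closedBall 0 1) ∧ InjOn Φ (ball 0 1) ∧
      Φ '' ball 0 1 = D.cell i ∧ ∀ x ∈ sphere 0 1, Φ x ∈ D.skel m := by
  subst h
  exact ⟨D.map i, D.continuousOn i, D.injOn i, rfl, fun _ => D.map_mem_skel⟩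

/-- Every point is a vertex of some subdivision. -/
theorem exists_vertex (D : CellStructure Y) {y : Y} (hy : y ∈ D.carrier) :
    ∃ D' : CellStructure Y, D'.carrier = D.carrier ∧ (∀ k, D.skel k ⊆ D'.skel k) ∧
      y ∈ D'.skel 1 := by
  -- The point varies in the induction: to make `y` inside the top cell a vertex, the smaller
  -- structure must first be subdivided at another point, the image of the pole.
  induction hN : Nat.card D.ι using Nat.strong_induction_on generalizing D y with
  | _ N ih =>
  subst hN
  obtain ⟨j, hj⟩ := D.mem_carrier.mp hy
  obtain ⟨i, hi⟩ := D.exists_dim_max ⟨j⟩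
  have hcar := D.carrier_eq_remove i hi
  by_cases hyA : y ∈ (D.remove i hi).carrier
  · obtain ⟨A, hA, hA', hyA'⟩ := ih _ (D.card_remove_lt i hi) (D.remove i hi) hyA rfl
    -- The removed cell can be reattached unchanged, because subdivision only enlarges each
    -- skeleton.
    have h := A.isAttached_attach (D.map i) (D.continuousOn i) (D.injOn i)
      (fun x hx => hA ▸ D.notMem_remove i hi ⟨x, hx, rfl⟩)
      (fun x hx => hA' _ (D.skel_subset_skel_remove i hi (D.map_mem_skel hx)))
    refine ⟨_, ?_, fun k z hz => ?_, h.skel_subset _ hyA'⟩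
    · rw [h.carrier_eq, hA, hcar]
      rfl
    · rcases D.mem_skel_remove i hi hz with hz | ⟨hk, hz⟩
      · exact h.skel_subset k (hA' k hz)
      · exact h.cell_subset k hk hz
  · have hyi : y ∈ D.cell i := by
      rw [hcar] at hy
      exact hy.resolve_left hyA
    rcases Nat.eq_zero_or_eq_succ_pred (D.dim i) with h0 | hn
    · exact ⟨D, rfl, fun _ => subset_rfl, i, by omega, hyi⟩
    generalize (D.dim i).pred = n at hn
    obtain ⟨Φ, hc, hinj, himg, hf⟩ := D.exists_charMap hn
    rw [← himg] at hyi
    obtain ⟨z, hz, rfl⟩ := hyi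
    have hp : ‖(1 / 2 : ℝ) • pole n‖ < 1 := by
      rw [norm_smul, norm_pole]
      norm_num
    -- Subdividing the cell creates a vertex at the point `(1 / 2) • pole n`. Reparametrizing by `e`
    -- places this vertex at `y`.
    obtain ⟨e, he, he', hez⟩ := exists_homeomorph_cube_apply_eq hp (mem_ball_zero_iff.mp hz)
    have hpole : pole n ∈ sphere (0 : Fin (n + 1) → ℝ) 1 := mem_sphere_zero_iff_norm.mpr norm_pole
    have hf' : ∀ x ∈ sphere 0 1, Φ x ∈ (D.remove i hi).skel (n + 1) := fun x hx => by
      have h := D.skel_subset_skel_remove i hi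
      rw [hn] at h
      exact h (hf x hx)
    obtain ⟨A, hA, hA', hv⟩ := ih _ (D.card_remove_lt i hi) (D.remove i hi)
      (skel_subset_carrier _ _ (hf' _ hpole)) rfl
    have hball : e '' ball 0 1 = ball 0 1 := by
      ext w
      constructor
      · rintro ⟨x, hx, rfl⟩
        rw [mem_ball_zero_iff] at hx ⊢
        exact (he x).mpr hx
      · intro hw
        refine ⟨e.symm w, ?_, e.apply_symm_apply w⟩
        rw [mem_ball_zero_iff] at hw ⊢
        rw [← he, e.apply_symm_apply]
        exact hw
    have himg' : Φ ∘ e '' ball 0 1 = D.cell i := by rw [image_comp, hball, himg]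
    obtain ⟨D', h1, h2, h3, h4, -, -⟩ := exists_subdivision (A := A) (Φ := Φ ∘ e)
      (hc.comp e.continuous.continuousOn fun x hx => by
        rw [← ball_union_sphere] at hx ⊢
        rcases hx with hx | hx
        · exact Or.inl (hball ▸ mem_image_of_mem e hx)
        · rw [he' x (mem_sphere_zero_iff_norm.mp hx)]
          exact Or.inr hx)
      (hinj.comp e.injective.injOn fun x hx => hball ▸ mem_image_of_mem e hx)
      (fun x hx => hA ▸ D.notMem_remove i hi (himg' ▸ mem_image_of_mem (Φ ∘ e) hx))
      (fun x hx => by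
        rw [Function.comp_apply, he' x (mem_sphere_zero_iff_norm.mp hx)]
        exact hA' _ (hf' x hx))
      (by rwa [Function.comp_apply, he' _ norm_pole])
    rw [himg'] at h1 h3
    rw [Function.comp_apply, hez] at h4
    refine ⟨D', by rw [h1, hA, hcar], fun k w hw => ?_, h4⟩
    rcases D.mem_skel_remove i hi hw with hw | ⟨hk, hw⟩
    · exact h2 k (hA' k hw)
    · exact h3 k (by omega) hw

theorem isUnion_remove (D : CellStructure Y) (i : D.ι) (hi : ∀ j, D.dim j ≤ D.dim i) :
    D.IsUnion (D.remove i hi).carrier := by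
  refine ⟨{j | j ≠ i}, ?_⟩
  ext y
  rw [mem_carrier, mem_iUnion₂]
  constructor
  · rintro ⟨j, hj⟩
    exact ⟨j.1, j.2, hj⟩
  · rintro ⟨j, hj, hj'⟩
    exact ⟨⟨j, hj⟩, hj'⟩

theorem exists_singleton (y : Y) : ∃ D : CellStructure Y, D.carrier = {y} := by
  have h := (empty Y).isAttached_attach (fun _ : Fin 0 → ℝ => y) continuousOn_const
    (fun x _ z _ _ => Subsingleton.elim x z) (fun _ _ => by rw [carrier_empty]; exact notMem_empty _)
    (fun x hx => by
      rw [mem_sphere_zero_iff_norm, Subsingleton.elim x 0, norm_zero] at hx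
      exact absurd hx zero_ne_one)
  refine ⟨_, h.carrier_eq.trans ?_⟩
  rw [carrier_empty, empty_union]
  exact Nonempty.image_const ⟨0, by simp⟩ _

end CellStructure

/-! ### Induction over cells for properties of subsets -/

/-- The closure properties under which a property of subsets holds for all finite CW complexes. -/
structure CellInductive {Y : Type} [TopologicalSpace Y] (P : Set Y → Prop) : Prop where
  empty : P ∅
  singleton : ∀ y, P {y}
  retract : ∀ (D : CellStructure Y) (A : Set Y) (H : Y × unitInterval → Y), P D.carrier →
    D.carrier ⊆ A → ContinuousOn H (A ×ˢ univ) → (∀ y ∈ A, H (y, 0) = y) →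
    (∀ y ∈ A, H (y, 1) ∈ D.carrier) → (∀ y ∈ A, ∀ t, H (y, t) ∈ A) →
    (∀ y ∈ D.carrier, ∀ t, H (y, t) ∈ D.carrier) → P A
  union : ∀ (D : CellStructure Y) (K L : Set Y), IsClosed K → IsClosed L → D.IsUnion K →
    D.IsUnion L → K ∪ L = D.carrier → P K → P L → P (K ∩ L) → P D.carrier

namespace CellInductive

variable {Y : Type} [TopologicalSpace Y] [T2Space Y] {P : Set Y → Prop}

-- A deformation `h` of `K` is pushed forward along `Φ` and extended by the identity on `D.carrier`.
-- It descends because points over `D.carrier` do not move in the image and `Φ` is injective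
-- elsewhere.
open Classical in
theorem union_image (hP : CellInductive P) (D : CellStructure Y) (hD : P D.carrier)
    {W : Type*} [TopologicalSpace W] {K : Set W} (hK : IsCompact K) {Φ : W → Y}
    (hΦ : ContinuousOn Φ K) {h : W × unitInterval → W} (hc : ContinuousOn h (K ×ˢ univ))
    (hm : ∀ w ∈ K, ∀ t, h (w, t) ∈ K) (h0 : ∀ w ∈ K, h (w, 0) = w)
    (h1 : ∀ w ∈ K, Φ (h (w, 1)) ∈ D.carrier)
    (hfix : ∀ w ∈ K, ∀ t, Φ w ∈ D.carrier → Φ (h (w, t)) = Φ w)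
    (hinj : ∀ w ∈ K, ∀ w' ∈ K, Φ w = Φ w' → Φ w ∉ D.carrier → w = w') :
    P (D.carrier ∪ Φ '' K) := by
  rcases isEmpty_or_nonempty W with hW | hW
  · rwa [Subsingleton.elim K ∅, image_empty, union_empty]
  let H : Y × unitInterval → Y := fun q =>
    if q.1 ∈ D.carrier then q.1 else Φ (h (Function.invFunOn Φ K q.1, q.2))
  have hHD : ∀ y ∈ D.carrier, ∀ t, H (y, t) = y := fun y hy t => if_pos hy
  have hHΦ : ∀ w ∈ K, ∀ t, H (Φ w, t) = Φ (h (w, t)) := by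
    intro w hw t
    by_cases hwD : Φ w ∈ D.carrier
    · rw [hHD _ hwD, hfix w hw t hwD]
    · have hex : ∃ a ∈ K, Φ a = Φ w := ⟨w, hw, rfl⟩
      rw [hinj w hw _ (Function.invFunOn_mem hex) (Function.invFunOn_eq hex).symm hwD]
      change (if _ then _ else _) = _
      rw [if_neg (by rwa [Function.invFunOn_eq hex])]
      congr 3
      rw [Function.invFunOn_eq hex]
  have hcD : ContinuousOn H (D.carrier ×ˢ univ) :=
    continuousOn_fst.congr fun q hq => hHD q.1 hq.1 q.2
  have hcΦ : ContinuousOn H ((Φ '' K) ×ˢ univ) := by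
    -- Since `K` and the interval are compact, `Φ × id` is a quotient map onto its image, so
    -- continuity may be tested before applying `Φ`.
    have := continuousOn_image_of_isCompact (q := Prod.map Φ (id : unitInterval → unitInterval))
      (g := H) (hK.prod isCompact_univ) (hΦ.prodMap continuousOn_id)
      ((hΦ.comp hc fun q hq => hm q.1 hq.1 q.2).congr fun q hq => hHΦ q.1 hq.1 q.2)
    rwa [prodMap_image_prod, image_id] at this
  refine hP.retract D _ H hD subset_union_left ?_ ?_ ?_ ?_ ?_
  · rw [union_prod]
    exact hcD.union_of_isClosed hcΦ (D.isCompact_carrier.isClosed.prod isClosed_univ)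
      ((hK.image_of_continuousOn hΦ).isClosed.prod isClosed_univ)
  · rintro y (hy | ⟨w, hw, rfl⟩)
    · exact hHD y hy 0
    · rw [hHΦ w hw, h0 w hw]
  · rintro y (hy | ⟨w, hw, rfl⟩)
    · rwa [hHD y hy]
    · rw [hHΦ w hw]
      exact h1 w hw
  · rintro y (hy | ⟨w, hw, rfl⟩) t
    · rw [hHD y hy]
      exact Or.inl hy
    · rw [hHΦ w hw]
      exact Or.inr ⟨_, hm w hw t, rfl⟩
  · intro y hy t
    rwa [hHD y hy]

section Cell

variable {n : ℕ} {Φ : (Fin (n + 1) → ℝ) → Y}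

/-- The half-size cube is embedded, and scaling contracts it to the image of its centre. -/
theorem image_half (hP : CellInductive P) (hc : ContinuousOn Φ (closedBall 0 1))
    (hi : InjOn Φ (ball 0 1)) : P (Φ '' closedBall 0 (1 / 2)) := by
  obtain ⟨D, hD⟩ := CellStructure.exists_singleton (Φ 0)
  have hsub : closedBall (0 : Fin (n + 1) → ℝ) (1 / 2) ⊆ ball 0 1 :=
    closedBall_subset_ball (by norm_num)
  have h0 : (0 : Fin (n + 1) → ℝ) ∈ closedBall 0 (1 / 2) := mem_closedBall_self (by norm_num)
  have h := hP.union_image D (hD ▸ hP.singleton _) (isCompact_closedBall 0 (1 / 2))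
    (hc.mono (hsub.trans ball_subset_closedBall))
    (h := fun q => (1 - (q.2 : ℝ)) • q.1) (by fun_prop)
    (fun w hw t => by
      rw [mem_closedBall_zero_iff] at hw ⊢
      rw [norm_smul, Real.norm_of_nonneg (sub_nonneg.mpr t.2.2)]
      nlinarith [norm_nonneg w, t.2.1])
    (fun w _ => by simp) (fun w _ => by simp [hD])
    (fun w hw t hw' => by
      rw [hD] at hw'
      rw [hi (hsub hw) (hsub h0) hw', smul_zero])
    (fun w hw w' hw' h _ => hi (hsub hw) (hsub hw') h)
  have h2 : {Φ 0} ⊆ Φ '' closedBall 0 (1 / 2) := singleton_subset_iff.mpr ⟨0, h0, rfl⟩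
  rwa [hD, union_eq_right.mpr h2] at h

/-- Push the shell radially outwards: the norm moves linearly from `‖w‖` to 1, and the unit sphere
is mapped into `D.carrier`. -/
theorem union_shell (hP : CellInductive P) (D : CellStructure Y) (hD : P D.carrier)
    (hc : ContinuousOn Φ (closedBall 0 1)) (hi : InjOn Φ (ball 0 1))
    (hd : ∀ x ∈ ball 0 1, Φ x ∉ D.carrier) (hf : ∀ x ∈ sphere 0 1, Φ x ∈ D.carrier) :
    P (D.carrier ∪ Φ '' (closedBall 0 1 \ ball 0 (1 / 2))) := by
  have hmem : ∀ w : Fin (n + 1) → ℝ, w ∈ closedBall (0 : Fin (n + 1) → ℝ) 1 \ ball 0 (1 / 2) ↔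
      ‖w‖ ≤ 1 ∧ 1 / 2 ≤ ‖w‖ := fun w => by
    rw [mem_sdiff, mem_closedBall_zero_iff, mem_ball_zero_iff, not_lt]
  have hnorm : ∀ w : Fin (n + 1) → ℝ, 1 / 2 ≤ ‖w‖ → ∀ t : unitInterval,
      ‖((1 - (t : ℝ)) + t * ‖w‖⁻¹) • w‖ = (1 - t) * ‖w‖ + t := by
    intro w hw t
    have h0 : 0 < ‖w‖ := by linarith
    have h1 := sub_nonneg.mpr t.2.2
    have h2 := t.2.1
    rw [norm_smul, Real.norm_of_nonneg (by positivity), add_mul, mul_assoc,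
      inv_mul_cancel₀ h0.ne', mul_one]
  have hout : ∀ w : Fin (n + 1) → ℝ, ‖w‖ ≤ 1 → Φ w ∈ D.carrier → ‖w‖ = 1 := fun w hw hw' =>
    hw.eq_of_not_lt fun h => hd w (mem_ball_zero_iff.mpr h) hw'
  refine hP.union_image D hD ((isCompact_closedBall 0 1).diff isOpen_ball)
    (hc.mono sdiff_subset)
    (h := fun q => ((1 - (q.2 : ℝ)) + q.2 * ‖q.1‖⁻¹) • q.1) ?_ ?_ ?_ ?_ ?_ ?_
  · have h : ∀ q ∈ (closedBall (0 : Fin (n + 1) → ℝ) 1 \ ball 0 (1 / 2)) ×ˢ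
        (univ : Set unitInterval), ‖q.1‖ ≠ 0 := fun q hq => by
      have := ((hmem _).mp hq.1).2
      linarith
    fun_prop (disch := assumption)
  · intro w hw t
    rw [hmem] at hw ⊢
    rw [hnorm w hw.2]
    constructor <;> nlinarith [t.2.1, t.2.2]
  · intro w _
    simp
  · intro w hw
    rw [hmem] at hw
    refine hf _ (mem_sphere_zero_iff_norm.mpr ?_)
    rw [hnorm w hw.2]
    simp
  · intro w hw t hw'
    rw [hmem] at hw
    rw [hout w hw.1 hw']
    simp
  · intro w hw w' hw' h hwD
    rw [hmem] at hw hw'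
    have hb : ∀ w : Fin (n + 1) → ℝ, ‖w‖ ≤ 1 → Φ w ∉ D.carrier → w ∈ ball 0 1 := fun w hw hw' =>
      mem_ball_zero_iff.mpr (hw.lt_of_ne fun h => hw' (hf w (mem_sphere_zero_iff_norm.mpr h)))
    exact hi (hb w hw.1 hwD) (hb w' hw'.1 (h ▸ hwD)) h

end Cell

/-- Two nested inductions. The cell count handles the complement of a cell of maximal dimension; the
dimension bound handles the sphere along which that cell is cut, whose number of cells is not
controlled. -/
theorem carrier_of_dim_lt (hP : CellInductive P) (N : ℕ) :
    ∀ D : CellStructure Y, (∀ i, D.dim i < N) → P D.carrier := by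
  induction N with
  | zero =>
    intro D hD
    have h : D.carrier = ∅ := by
      rw [eq_empty_iff_forall_notMem]
      intro y hy
      obtain ⟨i, -⟩ := D.mem_carrier.mp hy
      exact (hD i).not_ge (Nat.zero_le _)
    exact h ▸ hP.empty
  | succ N ihN =>
    intro D hD
    induction hk : Nat.card D.ι using Nat.strong_induction_on generalizing D with
    | _ k ih =>
    subst hk
    by_cases hne : Nonempty D.ι
    · obtain ⟨i, hi⟩ := D.exists_dim_max hne
      have hcar := D.carrier_eq_remove i hi
      have hA := ih _ (D.card_remove_lt i hi) (D.remove i hi) (fun j => hD j.1) rfl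
      have hdisj : ∀ y ∈ D.cell i, y ∉ (D.remove i hi).carrier := fun y => D.notMem_remove i hi
      rcases Nat.eq_zero_or_eq_succ_pred (D.dim i) with h0 | hn
      · obtain ⟨Φ, -, -, himg, -⟩ := D.exists_charMap h0
        have hcell : D.cell i = {Φ 0} := by
          rw [← himg]
          refine subset_antisymm ?_ (singleton_subset_iff.mpr ⟨0, by simp, rfl⟩)
          rintro _ ⟨x, -, rfl⟩
          rw [Subsingleton.elim x 0]
          rfl
        refine hP.union D (D.remove i hi).carrier (D.cell i)
          (D.remove i hi).isCompact_carrier.isClosed (hcell ▸ isClosed_singleton)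
          (D.isUnion_remove i hi) (D.isUnion_cell i) hcar.symm hA (hcell ▸ hP.singleton _) ?_
        rw [inter_comm, (disjoint_left.mpr hdisj).inter_eq]
        exact hP.empty
      · have hdim := hD i
        generalize (D.dim i).pred = n at hn
        obtain ⟨Φ, hc, hinj, himg, hf⟩ := D.exists_charMap hn
        rw [← himg] at hdisj hcar
        have hd : ∀ x ∈ ball 0 1, Φ x ∉ (D.remove i hi).carrier := fun x hx =>
          hdisj _ ⟨x, hx, rfl⟩
        have hf' : ∀ x ∈ sphere 0 1, Φ x ∈ (D.remove i hi).skel (n + 1) := fun x hx => by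
          have h := D.skel_subset_skel_remove i hi
          rw [hn] at h
          exact h (hf x hx)
        -- `A` may have more cells than the structure it subdivides, but `P` sees only the carrier,
        -- so the induction hypothesis already obtained still applies.
        obtain ⟨A, hAcar, hAskel, hv⟩ := (D.remove i hi).exists_vertex
          ((D.remove i hi).skel_subset_carrier _
            (hf' (pole n) (mem_sphere_zero_iff_norm.mpr norm_pole)))
        rw [← hAcar] at hA hcar hd
        obtain ⟨D', h1, -, -, -, h2, h3⟩ := CellStructure.exists_subdivision hc hinj hd
          (fun x hx => hAskel _ (hf' x hx)) hv
        obtain ⟨S, hS, hSdim⟩ := CellStructure.exists_sphere hc hinj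
        have hfA : ∀ x ∈ sphere 0 1, Φ x ∈ A.carrier := fun x hx =>
          A.skel_subset_carrier _ (hAskel _ (hf' x hx))
        have hsub : closedBall (0 : Fin (n + 1) → ℝ) (1 / 2) ⊆ ball 0 1 :=
          closedBall_subset_ball (by norm_num)
        rw [hcar, ← h1]
        refine hP.union D' _ _ ?_ ?_ h2 h3 ?_ (hP.union_shell A hA hc hinj hd hfA)
          (hP.image_half hc hinj) ?_
        · exact (A.isCompact_carrier.union (((isCompact_closedBall 0 1).diff
            isOpen_ball).image_of_continuousOn (hc.mono sdiff_subset))).isClosed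
        · exact ((isCompact_closedBall 0 (1 / 2)).image_of_continuousOn
            (hc.mono (hsub.trans ball_subset_closedBall))).isClosed
        · rw [h1]
          refine subset_antisymm (union_subset (union_subset subset_union_left ?_) ?_)
            (union_subset (subset_union_left.trans subset_union_left) ?_)
          · rintro _ ⟨w, ⟨hw, -⟩, rfl⟩
            rw [← ball_union_sphere] at hw
            rcases hw with hw | hw
            · exact Or.inr ⟨w, hw, rfl⟩
            · exact Or.inl (hfA w hw)
          · exact (image_mono hsub).trans subset_union_right
          · rintro _ ⟨w, hw, rfl⟩
            by_cases hw' : w ∈ ball (0 : Fin (n + 1) → ℝ) (1 / 2)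
            · exact Or.inr ⟨w, ball_subset_closedBall hw', rfl⟩
            · exact Or.inl (Or.inr ⟨w, ⟨ball_subset_closedBall hw, hw'⟩, rfl⟩)
        · have hinter : (A.carrier ∪ Φ '' (closedBall 0 1 \ ball 0 (1 / 2))) ∩
              Φ '' closedBall 0 (1 / 2) = Φ '' sphere 0 (1 / 2) := by
            ext y
            constructor
            · rintro ⟨hy, w, hw, rfl⟩
              refine ⟨w, ?_, rfl⟩
              rcases hy with hy | ⟨w', ⟨hw1, hw2⟩, hw'⟩
              · exact absurd hy (hd w (hsub hw))
              · rw [← ball_union_sphere] at hw1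
                rcases hw1 with hw1 | hw1
                · rw [hinj hw1 (hsub hw) hw'] at hw2
                  rw [mem_sphere_zero_iff_norm]
                  rw [mem_ball_zero_iff, not_lt] at hw2
                  exact le_antisymm (mem_closedBall_zero_iff.mp hw) hw2
                · exact absurd (hw' ▸ hfA w' hw1) (hd w (hsub hw))
            · rintro ⟨w, hw, rfl⟩
              have hw' := sphere_subset_closedBall hw
              refine ⟨Or.inr ⟨w, ⟨ball_subset_closedBall (hsub hw'), fun h => ?_⟩, rfl⟩,
                w, hw', rfl⟩
              exact (mem_ball_zero_iff.mp h).ne (mem_sphere_zero_iff_norm.mp hw)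
          rw [hinter, ← hS]
          -- The sphere has cells of dimension at most `n`, and `n + 1 = D.dim i ≤ N`.
          exact ihN S fun j => (hSdim j).trans_le (by omega)
    · exact ihN D fun i => absurd ⟨i⟩ hne

theorem carrier (hP : CellInductive P) (D : CellStructure Y) : P D.carrier := by
  obtain ⟨N, hN⟩ := (finite_range D.dim).bddAbove
  exact hP.carrier_of_dim_lt (N + 1) D fun i => Nat.lt_succ_of_le (hN ⟨i, rfl⟩)

end CellInductive

end HigherTwist

namespace HigherTwist

open Set

/-! ### Covering homotopies for principal bundles -/

namespace PrincipalBundle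

variable {G : Type*} [Group G] [TopologicalSpace G] {E B : Type*}
  [TopologicalSpace E] [TopologicalSpace B] [MulAction Gᵐᵒᵖ E] (p : PrincipalBundle G E B)

/-- Equivariance of a local trivialization. -/
def IsEquivariant (t : Bundle.Trivialization G p.proj) : Prop :=
  ∀ e ∈ t.source, ∀ g : G, (t (op g • e)).2 = (t e).2 * g

variable {p}

theorem eq_of_proj_eq {t : Bundle.Trivialization G p.proj} {e e' : E} (he : p.proj e ∈ t.baseSet)
    (h : p.proj e = p.proj e') (h' : (t e).2 = (t e').2) : e = e' := by
  have hs : e ∈ t.source := t.mem_source.mpr he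
  have hs' : e' ∈ t.source := t.mem_source.mpr (h ▸ he)
  rw [← t.symm_apply_mk_proj hs, ← t.symm_apply_mk_proj hs', h, h']

variable (p) in
theorem exists_smul_eq {e e' : E} (h : p.proj e = p.proj e') : ∃ g : G, e' = op g • e := by
  obtain ⟨t, ht, hg⟩ := p.locally_trivial (p.proj e)
  refine ⟨(t e).2⁻¹ * (t e').2, eq_of_proj_eq (t := t) (h ▸ ht) ?_ ?_⟩
  · rw [p.proj_act, h]
  · rw [hg e (t.mem_source.mpr ht), mul_inv_cancel_left]

/-- Transport of a point of the total space to the fibre over `b` in a local trivialization. -/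
def transport (t : Bundle.Trivialization G p.proj) (e : E) (b : B) : E :=
  t.toOpenPartialHomeomorph.symm (b, (t e).2)

variable {t : Bundle.Trivialization G p.proj}

theorem proj_transport (e : E) {b : B} (hb : b ∈ t.baseSet) : p.proj (transport t e b) = b :=
  t.proj_symm_apply' hb

theorem transport_proj {e : E} (he : p.proj e ∈ t.baseSet) : transport t e (p.proj e) = e :=
  t.symm_apply_mk_proj (t.mem_source.mpr he)

theorem transport_smul (ht : p.IsEquivariant t) {e : E} (he : p.proj e ∈ t.baseSet) {b : B}
    (hb : b ∈ t.baseSet) (g : Gᵐᵒᵖ) : transport t (g • e) b = g • transport t e b := by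
  have h1 : p.proj (transport t (g • e) b) = b := proj_transport _ hb
  have h2 : p.proj (transport t e b) = b := proj_transport _ hb
  refine eq_of_proj_eq (t := t) (h1.symm ▸ hb) ?_ ?_
  · rw [h1, p.proj_act, h2]
  · obtain ⟨g, rfl⟩ := MulOpposite.op_surjective g
    rw [ht _ (t.mem_source.mpr (h2.symm ▸ hb))]
    simp only [transport]
    rw [t.apply_symm_apply' hb, t.apply_symm_apply' hb]
    exact ht e (t.mem_source.mpr he) g

theorem continuousOn_transport :
    ContinuousOn (fun q : E × B => transport t q.1 q.2) ((p.proj ⁻¹' t.baseSet) ×ˢ t.baseSet) := by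
  have h1 : ContinuousOn (fun q : E × B => (q.2, (t q.1).2))
      ((p.proj ⁻¹' t.baseSet) ×ˢ t.baseSet) := by
    refine continuousOn_snd.prodMk (continuous_snd.comp_continuousOn ?_)
    refine t.continuousOn_toFun.comp continuousOn_fst fun q hq => ?_
    exact t.mem_source.mpr hq.1
  refine t.toOpenPartialHomeomorph.continuousOn_symm.comp h1 fun q hq => ?_
  exact t.mem_target.mpr hq.2

section Lifting

variable {X : Type*} [TopologicalSpace X]

/-- A homotopy `g` on `X × ℝ` that is constant for negative times has a lift to `p` on the part
of `f^* E` where the time is at most `s`. -/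
def LiftsUpTo (p : PrincipalBundle G E B) (f : X → B) (g : X × ℝ → B) (s : X → ℝ) : Prop :=
  ∃ L : Pull p f × ℝ → E, Continuous L ∧
    (∀ z t, p.proj (L (z, t)) = g (z.pt, min t (s z.pt))) ∧
    (∀ z t (a : Gᵐᵒᵖ), L (a • z, t) = a • L (z, t)) ∧ ∀ z, ∀ t ≤ 0, L (z, t) = z.1.2

variable {f : X → B} {g : X × ℝ → B}

theorem liftsUpTo_zero (hf : ∀ x, ∀ t ≤ 0, g (x, t) = f x) : LiftsUpTo p f g fun _ => 0 :=
  ⟨fun q => q.1.1.2, continuous_snd.comp (continuous_subtype_val.comp continuous_fst),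
    fun z _ => z.2.symm.trans (hf _ _ (min_le_right _ _)).symm, fun _ _ _ => rfl, fun _ _ _ => rfl⟩

-- Where `s` and `s'` differ, the homotopy between these times stays in one trivializing set. There
-- the lift, which already sits over the time `s` for all later times, is carried on by keeping its
-- fibre coordinate.
open Classical in
theorem LiftsUpTo.extend (hg : Continuous g) {s s' : X → ℝ} (h : LiftsUpTo p f g s)
    (hs : Continuous s) (hs' : Continuous s') (h0 : ∀ x, 0 ≤ s x) (hss' : ∀ x, s x ≤ s' x)
    {C₁ C₂ : Set X} (hC₁ : IsClosed C₁) (hC₂ : IsClosed C₂) (hC : ∀ x, x ∈ C₁ ∨ x ∈ C₂)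
    (h1 : ∀ x ∈ C₁, s x = s' x) {t : Bundle.Trivialization G p.proj} (ht : p.IsEquivariant t)
    (h2 : ∀ x ∈ C₂, ∀ τ ∈ Icc (s x) (s' x), g (x, τ) ∈ t.baseSet) : LiftsUpTo p f g s' := by
  obtain ⟨L, hL, hLp, hLa, hL0⟩ := h
  let T : Pull p f × ℝ → E := fun q => transport t (L q) (g (q.1.pt, min q.2 (s' q.1.pt)))
  let K₁ : Set (Pull p f × ℝ) := {q | q.2 ≤ s q.1.pt ∨ q.1.pt ∈ C₁}
  let K₂ : Set (Pull p f × ℝ) := {q | s q.1.pt ≤ q.2 ∧ q.1.pt ∈ C₂}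
  have hpt : Continuous fun q : Pull p f × ℝ => q.1.pt := Pull.continuous_pt.comp continuous_fst
  have hK₁ : IsClosed K₁ := (isClosed_le continuous_snd (hs.comp hpt)).union (hC₁.preimage hpt)
  have hK₂ : IsClosed K₂ := (isClosed_le (hs.comp hpt) continuous_snd).inter (hC₂.preimage hpt)
  have hK : ∀ q, q ∉ K₁ → q ∈ K₂ := fun q hq => by
    rw [show (q ∉ K₁) = ¬ (q.2 ≤ s q.1.pt ∨ q.1.pt ∈ C₁) from rfl, not_or, not_le] at hq
    exact ⟨hq.1.le, (hC _).resolve_left hq.2⟩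
  have hb₁ : ∀ q ∈ K₂, p.proj (L q) ∈ t.baseSet := fun q hq => by
    rw [hLp, min_eq_right hq.1]
    exact h2 _ hq.2 _ ⟨le_rfl, hss' _⟩
  have hb₂ : ∀ q ∈ K₂, g (q.1.pt, min q.2 (s' q.1.pt)) ∈ t.baseSet := fun q hq =>
    h2 _ hq.2 _ ⟨le_min hq.1 (hss' _), min_le_right _ _⟩
  have hmin : ∀ q ∈ K₁, min q.2 (s q.1.pt) = min q.2 (s' q.1.pt) := by
    rintro q (hq | hq)
    · rw [min_eq_left hq, min_eq_left (hq.trans (hss' _))]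
    · rw [h1 _ hq]
  -- On the overlap both sides lie over the same point of the base, and transport within one fibre
  -- is the identity. The two closed pieces therefore glue.
  have hLT : ∀ q ∈ K₁ ∩ K₂, L q = T q := by
    rintro q ⟨hq₁, hq₂⟩
    change _ = transport t _ _
    rw [← hmin q hq₁, ← hLp, transport_proj (hb₁ q hq₂)]
  let L' : Pull p f × ℝ → E := fun q => if q ∈ K₁ then L q else T q
  have hL₁ : ∀ q ∈ K₁, L' q = L q := fun q hq => if_pos hq
  have hL₂ : ∀ q ∈ K₂, L' q = T q := fun q hq => by
    by_cases hq' : q ∈ K₁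
    · rw [hL₁ q hq', hLT q ⟨hq', hq⟩]
    · exact if_neg hq'
  refine ⟨L', ?_, ?_, ?_, ?_⟩
  · rw [← continuousOn_univ, ← eq_univ_of_forall fun q => or_iff_not_imp_left.mpr (hK q)]
    refine ContinuousOn.union_of_isClosed (hL.continuousOn.congr hL₁) ?_ hK₁ hK₂
    refine ContinuousOn.congr ?_ hL₂
    refine continuousOn_transport.comp (f := fun q : Pull p f × ℝ =>
      (L q, g (q.1.pt, min q.2 (s' q.1.pt)))) ?_ fun q hq => ⟨hb₁ q hq, hb₂ q hq⟩
    exact (hL.prodMk (hg.comp (hpt.prodMk (continuous_snd.min (hs'.comp hpt))))).continuousOn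
  · intro z τ
    by_cases hq : (z, τ) ∈ K₁
    · rw [hL₁ _ hq, hLp]
      exact congrArg (fun r => g (z.pt, r)) (hmin _ hq)
    · rw [hL₂ _ (hK _ hq)]
      exact proj_transport _ (hb₂ _ (hK _ hq))
  · intro z τ a
    by_cases hq : (z, τ) ∈ K₁
    · rw [hL₁ _ hq, hL₁ (a • z, τ) hq, hLa]
    · rw [hL₂ _ (hK _ hq), hL₂ (a • z, τ) (hK (z, τ) hq)]
      change transport t (L (a • z, τ)) _ = _
      rw [hLa]
      exact transport_smul ht (hb₁ _ (hK _ hq)) (hb₂ _ (hK _ hq)) a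
  · intro z τ hτ
    rw [hL₁ _ (Or.inl (hτ.trans (h0 _))), hL0 z τ hτ]

/-- A Lebesgue number for the path at `x` gives the subdivision of the time interval; compactness of
each subinterval spreads it to a neighbourhood of `x`. -/
theorem exists_subdivided_trivialization (hg : Continuous g) (x : X) :
    ∃ N : ℕ, 0 < N ∧ ∃ U : Set X, IsOpen U ∧ x ∈ U ∧ ∀ k : Fin N,
      ∃ t : Bundle.Trivialization G p.proj, p.IsEquivariant t ∧
      ∀ y ∈ U, ∀ τ ∈ Icc ((k : ℝ) / N) ((k + 1 : ℝ) / N), g (y, τ) ∈ t.baseSet := by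
  choose t ht hte using p.locally_trivial
  obtain ⟨δ, hδ, hball⟩ := lebesgue_number_lemma_of_metric (s := Icc (0 : ℝ) 1)
    (c := fun b : B => (fun τ => g (x, τ)) ⁻¹' (t b).baseSet) isCompact_Icc
    (fun b => (t b).open_baseSet.preimage (hg.comp (Continuous.prodMk_right x)))
    (fun τ _ => mem_iUnion.mpr ⟨g (x, τ), ht _⟩)
  obtain ⟨n, hn⟩ := exists_nat_one_div_lt hδ
  suffices h : ∀ k : Fin (n + 1), ∃ b, ∀ᶠ y in 𝓝 x, ∀ τ ∈ Icc ((k : ℝ) / (n + 1 : ℕ))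
      ((k + 1 : ℝ) / (n + 1 : ℕ)), g (y, τ) ∈ (t b).baseSet by
    choose b hb using h
    obtain ⟨U, hU, hUo, hxU⟩ := eventually_nhds_iff.mp (Filter.eventually_all.mpr hb)
    exact ⟨n + 1, n.succ_pos, U, hUo, hxU, fun k => ⟨t (b k), hte _, fun y hy => hU y hy k⟩⟩
  intro k
  have hN : (0 : ℝ) < (n + 1 : ℕ) := by positivity
  obtain ⟨b, hb⟩ := hball ((k : ℝ) / (n + 1 : ℕ)) ⟨by positivity, by
    rw [div_le_one hN]
    exact_mod_cast k.2.le⟩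
  have hIcc : ∀ τ ∈ Icc ((k : ℝ) / (n + 1 : ℕ)) ((k + 1 : ℝ) / (n + 1 : ℕ)),
      g (x, τ) ∈ (t b).baseSet := fun τ hτ => hb (by
    rw [Metric.mem_ball, Real.dist_eq, abs_of_nonneg (sub_nonneg.mpr hτ.1)]
    have h := hτ.2
    rw [add_div] at h
    push_cast at h hn ⊢
    linarith)
  refine ⟨b, isCompact_Icc.eventually_forall_of_forall_eventually
    (P := fun y τ => g (y, τ) ∈ (t b).baseSet) fun τ hτ => ?_⟩
  exact hg.continuousAt.eventually ((t b).open_baseSet.mem_nhds (hIcc τ hτ))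

/-- The lift climbs from `s` to `s + ρ` through the `N` time slabs, one at a time, using the
truncations of `s + ρ` at `k / N`. -/
theorem LiftsUpTo.add (hg : Continuous g) {s ρ : X → ℝ} (h : LiftsUpTo p f g s)
    (hs : Continuous s) (hρ : Continuous ρ) (hs0 : ∀ x, 0 ≤ s x) (hρ0 : ∀ x, 0 ≤ ρ x)
    (h1 : ∀ x, s x + ρ x ≤ 1) {N : ℕ} (hN : 0 < N)
    {U : Set X} (hρU : tsupport ρ ⊆ U)
    (htr : ∀ k : Fin N, ∃ t : Bundle.Trivialization G p.proj, p.IsEquivariant t ∧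
      ∀ y ∈ U, ∀ τ ∈ Icc ((k : ℝ) / N) ((k + 1 : ℝ) / N), g (y, τ) ∈ t.baseSet) :
    LiftsUpTo p f g fun x => s x + ρ x := by
  have hN' : (0 : ℝ) < N := by exact_mod_cast hN
  have key : ∀ k : ℕ, k ≤ N → LiftsUpTo p f g fun x => max (s x) (min (s x + ρ x) (k / N)) := by
    intro k
    induction k with
    | zero =>
      intro _
      have h2 : (fun x => max (s x) (min (s x + ρ x) ((0 : ℕ) / N))) = s := by
        funext x
        rw [Nat.cast_zero, zero_div, min_eq_right (add_nonneg (hs0 x) (hρ0 x)),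
          max_eq_left (hs0 x)]
      rwa [h2]
    | succ k ih =>
      intro hk
      obtain ⟨t, ht, htU⟩ := htr ⟨k, hk⟩
      have hle : (k : ℝ) / N ≤ (k + 1 : ℕ) / N := by
        gcongr
        exact k.le_succ
      refine (ih (by omega)).extend hg
        -- On `C₁` consecutive truncations agree. On `C₂` the times between them lie in the `k`-th
        -- slab and the point in `U`, so a single trivialization serves.
        (C₁ := {x | ((k + 1 : ℕ) : ℝ) / N ≤ s x} ∪ {x | s x + ρ x ≤ (k : ℝ) / N} ∪ {x | ρ x = 0})
        (C₂ := {x | s x ≤ ((k + 1 : ℕ) : ℝ) / N} ∩ {x | (k : ℝ) / N ≤ s x + ρ x} ∩ tsupport ρ)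
        (by fun_prop) (by fun_prop) (fun x => (hs0 x).trans (le_max_left _ _))
        (fun x => max_le_max le_rfl (min_le_min le_rfl hle)) ?_ ?_ ?_ ?_ ht ?_
      · exact ((isClosed_le continuous_const hs).union
          (isClosed_le (hs.add hρ) continuous_const)).union (isClosed_eq hρ continuous_const)
      · exact ((isClosed_le hs continuous_const).inter
          (isClosed_le continuous_const (hs.add hρ))).inter (isClosed_tsupport ρ)
      · intro x
        rcases le_total (((k + 1 : ℕ) : ℝ) / N) (s x) with h2 | h2
        · exact Or.inl (Or.inl (Or.inl h2))
        rcases le_total (s x + ρ x) ((k : ℝ) / N) with h3 | h3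
        · exact Or.inl (Or.inl (Or.inr h3))
        by_cases h4 : ρ x = 0
        · exact Or.inl (Or.inr h4)
        · exact Or.inr ⟨⟨h2, h3⟩, subset_tsupport ρ h4⟩
      · rintro x ((hx | hx) | hx)
        · rw [max_eq_left ((min_le_right _ _).trans (hle.trans hx)),
            max_eq_left ((min_le_right _ _).trans hx)]
        · rw [min_eq_left hx, min_eq_left (le_trans hx hle)]
        · rw [show ρ x = 0 from hx, add_zero, max_eq_left (min_le_left _ _),
            max_eq_left (min_le_left _ _)]
      · rintro x ⟨⟨h2, h3⟩, h4⟩ τ ⟨h5, h6⟩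
        refine htU x (hρU h4) τ ⟨?_, ?_⟩
        · exact (le_max_right _ _).trans' (le_min h3 le_rfl) |>.trans h5
        · refine h6.trans ((max_le h2 (min_le_right _ _)).trans ?_)
          push_cast
          exact le_rfl
  have h2 := key N le_rfl
  rw [div_self hN'.ne'] at h2
  convert h2 using 2 with x
  rw [min_eq_left (h1 x), max_eq_right (le_add_of_nonneg_right (hρ0 x))]

/-- The covering homotopy theorem for pullbacks of principal bundles to compact spaces. -/
theorem liftsUpTo_one [CompactSpace X] [T2Space X] (hg : Continuous g)
    (hf : ∀ x, ∀ t ≤ 0, g (x, t) = f x) : LiftsUpTo p f g fun _ => 1 := by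
  choose N hN U hUo hxU htr using fun x : X => exists_subdivided_trivialization (p := p) hg x
  obtain ⟨S, -, hS⟩ := isCompact_univ.elim_nhds_subcover U fun x _ => (hUo x).mem_nhds (hxU x)
  obtain ⟨ρ, hρ⟩ := PartitionOfUnity.exists_isSubordinate (ι := S) isClosed_univ
    (fun i => U i) (fun i => hUo i) (fun x hx => by
      obtain ⟨i, hi, hx⟩ := mem_iUnion₂.mp (hS hx)
      exact mem_iUnion.mpr ⟨⟨i, hi⟩, hx⟩)
  have hsum : ∀ x, ∑ i, ρ i x = 1 := fun x => by
    rw [← finsum_eq_sum_of_fintype, ρ.sum_eq_one (mem_univ x)]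
  -- Partial sums of a partition of unity serve as intermediate times: adding one summand advances
  -- the lift only over the support of that function, where a subdivision into trivializing slabs is
  -- available.
  have key : ∀ T : Finset S, LiftsUpTo p f g fun x => ∑ i ∈ T, ρ i x := by
    classical
    intro T
    induction T using Finset.induction_on with
    | empty => exact liftsUpTo_zero hf
    | insert j T hj ih =>
      have h := ih.add (ρ := ρ j) hg (by fun_prop) (ρ j).continuous
        (fun x => Finset.sum_nonneg fun i _ => ρ.nonneg i x) (ρ.nonneg j)
        (fun x => by
          rw [add_comm, ← Finset.sum_insert (f := fun i => ρ i x) hj, ← hsum x]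
          exact Finset.sum_le_univ_sum_of_nonneg fun i => ρ.nonneg i x)
        (hN j) (hρ j) (htr j)
      convert h using 2 with x
      rw [Finset.sum_insert hj, add_comm]
  convert key Finset.univ using 2 with x
  exact (hsum x).symm

end Lifting
end PrincipalBundle
end HigherTwist

/-! ### Lifting homotopies of the base to homotopies of morphisms -/

namespace HigherTwist

open Set

section Lifts

variable {G : Type*} [Group G] [TopologicalSpace G] {E B : Type*}
  [TopologicalSpace E] [TopologicalSpace B] [MulAction Gᵐᵒᵖ E] {p : PrincipalBundle G E B}

theorem Pull.exists_smul_eq {X : Type*} {f : X → B} {z z' : Pull p f} (h : z.pt = z'.pt) :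
    ∃ g : G, z' = op g • z := by
  obtain ⟨g, hg⟩ := p.exists_smul_eq (z.2.symm.trans ((congrArg f h).trans z'.2))
  exact ⟨g, Subtype.ext (Prod.ext h.symm hg)⟩

variable {X : Type*} [TopologicalSpace X]

theorem Pull.exists_section (f : C(X, B)) (x : X) :
    ∃ U : Set X, IsOpen U ∧ x ∈ U ∧ ∃ σ : U → Pull p f, Continuous σ ∧ ∀ u, (σ u).pt = u := by
  obtain ⟨t, ht, -⟩ := p.locally_trivial (f x)
  refine ⟨f ⁻¹' t.baseSet, t.open_baseSet.preimage f.continuous, ht,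
    fun u => ⟨(u, t.toOpenPartialHomeomorph.symm (f u, 1)), (t.proj_symm_apply' u.2).symm⟩, ?_,
    fun _ => rfl⟩
  refine Continuous.subtype_mk (continuous_subtype_val.prodMk ?_) _
  exact t.toOpenPartialHomeomorph.continuousOn_symm.comp_continuous
    ((f.continuous.comp continuous_subtype_val).prodMk continuous_const)
    fun u => t.mem_target.mpr u.2

/-- Homotopies of a compact space that start at the identity lift to pullback bundles. -/
theorem Pull.exists_lift [CompactSpace X] [T2Space X] (f : C(X, B)) (H : C(X × unitInterval, X))
    (h0 : ∀ x, H (x, 0) = x) :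
    ∃ m : unitInterval → C(Pull p f, Pull p f), (∀ t z, (m t z).pt = H (z.pt, t)) ∧
      (∀ t z (g : Gᵐᵒᵖ), m t (g • z) = g • m t z) ∧ (∀ z, m 0 z = z) ∧
      Continuous fun q : Pull p f × unitInterval => m q.2 q.1 := by
  -- The homotopy is prolonged to all real times by clamping to the unit interval.
  obtain ⟨L, hL, hLp, hLa, hL0⟩ := PrincipalBundle.liftsUpTo_one (p := p) (f := f)
    (g := fun q => f (H (q.1, projIcc 0 1 zero_le_one q.2)))
    (f.continuous.comp (H.continuous.comp (continuous_fst.prodMk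
      (continuous_projIcc.comp continuous_snd))))
    (fun x t ht => by rw [projIcc_of_le_left _ ht]; exact congrArg f (h0 x))
  have hp : ∀ (z : Pull p f) (t : unitInterval), f (H (z.pt, t)) = p.proj (L (z, t)) := by
    intro z t
    rw [hLp, min_eq_left t.2.2]
    exact congrArg (fun s => f (H (z.pt, s))) (projIcc_val _ t).symm
  have hc : Continuous fun q : Pull p f × unitInterval =>
      (⟨(H (q.1.pt, q.2), L (q.1, q.2)), hp q.1 q.2⟩ : Pull p f) :=
    Continuous.subtype_mk ((H.continuous.comp ((Pull.continuous_pt.comp continuous_fst).prodMk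
      continuous_snd)).prodMk (hL.comp (continuous_fst.prodMk
      (continuous_subtype_val.comp continuous_snd)))) _
  refine ⟨fun t => ⟨fun z => ⟨(H (z.pt, t), L (z, t)), hp z t⟩,
    hc.comp (Continuous.prodMk_left t)⟩, fun _ _ => rfl, fun t z g => ?_, fun z => ?_, hc⟩
  · exact Subtype.ext (Prod.ext rfl (hLa z t g))
  · exact Subtype.ext (Prod.ext (h0 _) (hL0 z 0 le_rfl))

end Lifts

namespace TwistedCW

variable {G : Type*} [Group G] [TopologicalSpace G] {E B : Type*}
  [TopologicalSpace E] [TopologicalSpace B] [MulAction Gᵐᵒᵖ E]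
  {G₂ : Type*} [Group G₂] [TopologicalSpace G₂] {κ : G × G →* G₂} {p : PrincipalBundle G E B}

instance (X : TwistedCW κ p) : CompactSpace X.carrier :=
  isCompact_iff_compactSpace.mp (by
    have h := (CellStructure.ofCWComplex X.carrier).isCompact_carrier
    rwa [CellStructure.carrier_ofCWComplex] at h)

section Rho

variable (X Y : TwistedCW κ p)

theorem exists_section (x : X.carrier) : ∃ U : Set X.carrier, IsOpen U ∧ x ∈ U ∧
    ∃ σ : U → FibreProduct p X.f X.fInv, Continuous σ ∧ ∀ u, (σ u).1.1.pt = u := by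
  obtain ⟨U, hU, hxU, σ, hσ, hσU⟩ := Pull.exists_section (p := p) X.f x
  obtain ⟨V, hV, hxV, τ, hτ, hτV⟩ := Pull.exists_section (p := p) X.fInv x
  refine ⟨U ∩ V, hU.inter hV, ⟨hxU, hxV⟩, fun u => ⟨(σ ⟨u, u.2.1⟩, τ ⟨u, u.2.2⟩),
    (hσU ⟨u, u.2.1⟩).trans (hτV ⟨u, u.2.2⟩).symm⟩, ?_, fun u => hσU _⟩
  exact Continuous.subtype_mk ((hσ.comp (Continuous.subtype_mk continuous_subtype_val _)).prodMk
    (hτ.comp (Continuous.subtype_mk continuous_subtype_val _))) _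

variable {X}

/-- The tensor relation turns a change of representative into right multiplication by `κ (g, g')`.
The factor is the same for source and target of an equivariant map, so it cancels in the quotient of
their trivializations. -/
theorem triv_mk_smul (q q' : FibreProduct p X.f X.fInv) (g g' : G) (h : q'.1.1 = op g • q.1.1)
    (h' : q'.1.2 = op g' • q.1.2) :
    (X.triv (.mk q' 1)).2 = (X.triv (.mk q 1)).2 * κ (g, g') := by
  have h1 : (BundleTensor.mk q' 1 : BundleTensor κ p X.f X.fInv) = .mk q (1 * κ (g, g')) :=
    Quot.sound ⟨g, g', h, h', by rw [one_mul, mul_one]⟩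
  rw [h1, X.triv_act]

variable [IsTopologicalGroup G₂] (X) {T : Type*} [TopologicalSpace T]

/-- The change of trivialization of a family of maps of bundles. -/
theorem exists_rho (φ : T → X.carrier → Y.carrier) (m : T → C(Pull p X.f, Pull p Y.f))
    (m' : T → C(Pull p X.fInv, Pull p Y.fInv)) (hm : ∀ t z, (m t z).pt = φ t z.pt)
    (hm' : ∀ t z, (m' t z).pt = φ t z.pt) (em : ∀ t z (g : Gᵐᵒᵖ), m t (g • z) = g • m t z)
    (em' : ∀ t z (g : Gᵐᵒᵖ), m' t (g • z) = g • m' t z)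
    (cm : Continuous fun q : Pull p X.f × T => m q.2 q.1)
    (cm' : Continuous fun q : Pull p X.fInv × T => m' q.2 q.1) :
    ∃ ρ : C(X.carrier × T, G₂), ∀ (q : FibreProduct p X.f X.fInv) t,
      ρ (q.1.1.pt, t) * (X.triv (.mk q 1)).2 =
        (Y.triv (.mk (BundleTensor.fibreMap (φ t) (m t) (m' t) (hm t) (hm' t) q) 1)).2 := by
  let R : FibreProduct p X.f X.fInv × T → G₂ := fun r =>
    (Y.triv (.mk (BundleTensor.fibreMap (φ r.2) (m r.2) (m' r.2) (hm r.2) (hm' r.2) r.1) 1)).2 *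
      (X.triv (.mk r.1 1)).2⁻¹
  have hmk : ∀ Z : TwistedCW κ p, Continuous fun q : FibreProduct p Z.f Z.fInv =>
      (Z.triv (.mk q 1)).2 := fun Z => continuous_snd.comp (Z.triv.continuous.comp
    (continuous_quot_mk.comp (Continuous.prodMk_left 1)))
  have hR : Continuous R := by
    refine Continuous.mul ((hmk Y).comp (Continuous.subtype_mk ?_ _))
      ((hmk X).comp continuous_fst).inv
    have h1 : Continuous fun r : FibreProduct p X.f X.fInv × T => r.1.1 :=
      continuous_subtype_val.comp continuous_fst
    exact (cm.comp ((continuous_fst.comp h1).prodMk continuous_snd)).prodMk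
      (cm'.comp ((continuous_snd.comp h1).prodMk continuous_snd))
  have hconst : ∀ q q' t, q.1.1.pt = q'.1.1.pt → R (q, t) = R (q', t) := by
    intro q q' t h
    obtain ⟨g, hg⟩ := Pull.exists_smul_eq h
    obtain ⟨g', hg'⟩ := Pull.exists_smul_eq (q.2.symm.trans (h.trans q'.2))
    change _ * _ = _ * _
    rw [triv_mk_smul q q' g g' hg hg', triv_mk_smul (X := Y)
      (BundleTensor.fibreMap (φ t) (m t) (m' t) (hm t) (hm' t) q)
      (BundleTensor.fibreMap (φ t) (m t) (m' t) (hm t) (hm' t) q') g g'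
      ((congrArg (m t) hg).trans (em t _ _)) ((congrArg (m' t) hg').trans (em' t _ _)),
      mul_inv_rev, mul_assoc, mul_inv_cancel_left]
  have hsec : ∀ x : X.carrier, ∃ q : FibreProduct p X.f X.fInv, q.1.1.pt = x := fun x => by
    obtain ⟨U, -, hx, σ, -, hσ⟩ := X.exists_section x
    exact ⟨σ ⟨x, hx⟩, hσ _⟩
  choose s hs using hsec
  -- The chosen points `s x` need not vary continuously. Continuity holds because `R` depends only
  -- on the base point, so that `s` may be replaced by a continuous local section.
  refine ⟨⟨fun r => R (s r.1, r.2), ?_⟩, fun q t => ?_⟩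
  · refine continuous_iff_continuousAt.mpr fun r => ?_
    obtain ⟨U, hU, hx, σ, hσ, hσU⟩ := X.exists_section r.1
    have hemb := hU.isOpenEmbedding_subtypeVal.prodMap (IsOpenEmbedding.id (X := T))
    rw [show r = Prod.map Subtype.val id ((⟨r.1, hx⟩ : U), r.2) from rfl,
      ← hemb.continuousAt_iff]
    have h1 : ((fun r : X.carrier × T => R (s r.1, r.2)) ∘
        Prod.map (Subtype.val : U → X.carrier) id) = fun r => R (σ r.1, r.2) :=
      funext fun r => hconst _ _ _ ((hs _).trans (hσU _).symm)
    rw [h1]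
    exact (hR.comp ((hσ.comp continuous_fst).prodMk continuous_snd)).continuousAt
  · change R (s q.1.1.pt, t) * _ = _
    rw [hconst _ q t (hs _)]
    exact inv_mul_cancel_right _ _

/-- A homotopy of the base space that starts at the identity is covered by a homotopy of
morphisms. -/
theorem exists_lift_homotopy (H : C(X.carrier × unitInterval, X.carrier))
    (h0 : ∀ x, H (x, 0) = x) :
    ∃ F : unitInterval → (X ⟶ X), F 0 = 𝟙 X ∧ (∀ t x, (F t).base x = H (x, t)) ∧
      Continuous (fun q : Pull p X.f × unitInterval => (F q.2).map q.1) ∧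
      Continuous (fun q : Pull p X.fInv × unitInterval => (F q.2).mapInv q.1) ∧
      Continuous (fun q : X.carrier × unitInterval => (F q.2).rho q.1) := by
  obtain ⟨m, hm, em, m0, cm⟩ := Pull.exists_lift (p := p) X.f H h0
  obtain ⟨m', hm', em', m0', cm'⟩ := Pull.exists_lift (p := p) X.fInv H h0
  obtain ⟨ρ, hρ⟩ := X.exists_rho X (fun t x => H (x, t)) m m' hm hm' em em' cm cm'
  let F : unitInterval → (X ⟶ X) := fun t => Hom.mk (X := X) (Y := X)
    ⟨fun x => H (x, t), H.continuous.comp (Continuous.prodMk_left t)⟩ (m t) (m' t)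
    ⟨fun x => ρ (x, t), ρ.continuous.comp (Continuous.prodMk_left t)⟩ (hm t) (hm' t) (em t) (em' t)
    (fun z => by
      induction z using Quot.ind with
      | mk z =>
      obtain ⟨q, a⟩ := z
      refine Prod.ext ?_ ?_
      · refine (X.triv_fst _).trans ?_
        refine Eq.trans ?_ (congrArg (fun x => H (x, t)) (X.triv_fst _).symm)
        exact hm t _
      · have h1 := hρ q t
        have h2 : ∀ q : FibreProduct p X.f X.fInv,
            (X.triv (.mk q a)).2 = (X.triv (.mk q 1)).2 * a := fun q => by
          rw [← X.triv_act, one_mul]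
        change (X.triv (.mk (BundleTensor.fibreMap (fun x => H (x, t)) (m t) (m' t) (hm t)
          (hm' t) q) a)).2 =
          ρ ((X.triv (.mk q a)).1, t) * (X.triv (.mk q a)).2
        rw [h2, h2, ← h1, X.triv_fst, mul_assoc]
        rfl)
  refine ⟨F, Hom.ext (ContinuousMap.ext h0) (ContinuousMap.ext m0) (ContinuousMap.ext m0')
    (ContinuousMap.ext fun x => ?_), fun _ _ => rfl, cm, cm', ρ.continuous⟩
  obtain ⟨U, -, hx, σ, -, hσ⟩ := X.exists_section x
  have h1 := hρ (σ ⟨x, hx⟩) 0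
  rw [hσ] at h1
  have h2 : BundleTensor.fibreMap (fun x => H (x, 0)) (m 0) (m' 0) (hm 0) (hm' 0) (σ ⟨x, hx⟩) =
      σ ⟨x, hx⟩ := Subtype.ext (Prod.ext (m0 _) (m0' _))
  rw [h2] at h1
  exact mul_eq_right.mp h1

end Rho

section Retract

variable [IsTopologicalGroup G₂] (X : TwistedCW κ p) {Y : Type} [TopologicalSpace Y] [T2Space Y]
  (C : Set Y) [CWComplex C] [CWComplex.Finite C] (ψ : C(C, X.carrier))

/-- The factorization of a morphism through a pullback. -/
def liftPullback {Z : TwistedCW κ p} (F : Z ⟶ X) (b : C(Z.carrier, C))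
    (hb : ∀ z, ψ (b z) = F.base z) : Z ⟶ X.pullback C ψ :=
  Hom.mk (X := Z) (Y := X.pullback C ψ) b
    ⟨fun z => ⟨(b z.pt, (F.map z).1.2), (congrArg X.f ((hb _).trans (F.map_pt z).symm)).trans
      (F.map z).2⟩, Continuous.subtype_mk ((b.continuous.comp Pull.continuous_pt).prodMk
        (continuous_snd.comp (continuous_subtype_val.comp F.map.continuous))) _⟩
    ⟨fun z => ⟨(b z.pt, (F.mapInv z).1.2),
      (congrArg X.fInv ((hb _).trans (F.mapInv_pt z).symm)).trans (F.mapInv z).2⟩,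
      Continuous.subtype_mk ((b.continuous.comp Pull.continuous_pt).prodMk
        (continuous_snd.comp (continuous_subtype_val.comp F.mapInv.continuous))) _⟩
    F.rho (fun _ => rfl) (fun _ => rfl)
    (fun z g => Subtype.ext (Prod.ext rfl (congrArg (fun y => y.1.2) (F.map_act z g))))
    (fun z g => Subtype.ext (Prod.ext rfl (congrArg (fun y => y.1.2) (F.mapInv_act z g))))
    (fun z => by
      have h := congrArg Prod.snd (F.comm z)
      refine Prod.ext ?_ (Eq.trans ?_ h)
      · refine Eq.trans ?_ (congrArg b (Z.triv_fst z).symm)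
        induction z using Quot.ind
        rfl
      · refine congrArg (fun y => (X.triv y).2) ?_
        induction z using Quot.ind with
        | mk z =>
        refine congrArg (fun q => BundleTensor.mk q z.2) (Subtype.ext (Prod.ext ?_ ?_))
        · exact Subtype.ext (Prod.ext ((hb _).trans (F.map_pt _).symm) rfl)
        · exact Subtype.ext (Prod.ext ((hb _).trans (F.mapInv_pt _).symm) rfl))

theorem liftPullback_comp {Z : TwistedCW κ p} (F : Z ⟶ X) (b : C(Z.carrier, C))
    (hb : ∀ z, ψ (b z) = F.base z) : X.liftPullback C ψ F b hb ≫ X.pullbackHom C ψ = F :=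
  Hom.ext (ContinuousMap.ext hb)
    (ContinuousMap.ext fun _ => Subtype.ext (Prod.ext ((hb _).trans (F.map_pt _).symm) rfl))
    (ContinuousMap.ext fun _ => Subtype.ext (Prod.ext ((hb _).trans (F.mapInv_pt _).symm) rfl))
    (ContinuousMap.ext fun _ => one_mul _)

/-- The canonical morphism from the pullback to a deformation retract induces an isomorphism. -/
theorem isIso_map_pullbackHom {h : TwistedCW κ p ⥤ GradedObject ℤ AddCommGrpCat.{w}}
    (hh : HomotopyInvariant h) (H : C(X.carrier × unitInterval, X.carrier)) (r : C(X.carrier, C))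
    (K : C(C × unitInterval, C)) (H0 : ∀ x, H (x, 0) = x) (H1 : ∀ x, H (x, 1) = ψ (r x))
    (K0 : ∀ y, K (y, 0) = y) (K1 : ∀ y, K (y, 1) = r (ψ y))
    (hK : ∀ y t, ψ (K (y, t)) = H (ψ y, t)) : IsIso (h.map (X.pullbackHom C ψ)) := by
  obtain ⟨F, F0, hF, cm, cm', cρ⟩ := X.exists_lift_homotopy H H0
  -- `R` is the homotopy inverse: `F` joins the identity to `R ≫ X.pullbackHom C ψ`, and `L`, the
  -- restriction of `F` to the pullback, joins the identity to the other composite.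
  let R : X ⟶ X.pullback C ψ := X.liftPullback C ψ (F 1) r fun x => (H1 x).symm.trans (hF 1 x).symm
  let L : unitInterval → (X.pullback C ψ ⟶ X.pullback C ψ) := fun t =>
    X.liftPullback C ψ (X.pullbackHom C ψ ≫ F t)
      ⟨fun y => K (y, t), K.continuous.comp (Continuous.prodMk_left t)⟩
      fun y => (hK y t).trans (hF t (ψ y)).symm
  have hL0 : L 0 = 𝟙 _ := by
    refine Hom.ext (ContinuousMap.ext K0) (ContinuousMap.ext fun z => Subtype.ext
      (Prod.ext (K0 _) ?_)) (ContinuousMap.ext fun z => Subtype.ext (Prod.ext (K0 _) ?_))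
      (ContinuousMap.ext fun y => ?_)
    · change ((F 0).map _).1.2 = _
      rw [F0]
      rfl
    · change ((F 0).mapInv _).1.2 = _
      rw [F0]
      rfl
    · change (F 0).rho _ * 1 = _
      rw [F0]
      exact mul_one _
  have hL1 : L 1 = X.pullbackHom C ψ ≫ R :=
    Hom.ext (ContinuousMap.ext K1)
      (ContinuousMap.ext fun z => Subtype.ext (Prod.ext (K1 _) rfl))
      (ContinuousMap.ext fun z => Subtype.ext (Prod.ext (K1 _) rfl))
      (ContinuousMap.ext fun _ => rfl)
  have e1 : h.map R ≫ h.map (X.pullbackHom C ψ) = 𝟙 _ := by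
    rw [← h.map_comp, liftPullback_comp, ← h.map_id]
    refine (hh _ _ ⟨F, F0, rfl, ?_, cm, cm', cρ⟩).symm
    simp only [hF]
    exact H.continuous
  have e2 : h.map (X.pullbackHom C ψ) ≫ h.map R = 𝟙 _ := by
    rw [← h.map_comp, ← hL1, ← h.map_id]
    refine (hh _ _ ⟨L, hL0, rfl, K.continuous, ?_, ?_, ?_⟩).symm
    · exact Continuous.subtype_mk ((K.continuous.comp ((Pull.continuous_pt.comp
        continuous_fst).prodMk continuous_snd)).prodMk (continuous_snd.comp
        (continuous_subtype_val.comp (cm.comp (((Pull.baseChange X.f ψ).continuous.comp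
        continuous_fst).prodMk continuous_snd))))) _
    · exact Continuous.subtype_mk ((K.continuous.comp ((Pull.continuous_pt.comp
        continuous_fst).prodMk continuous_snd)).prodMk (continuous_snd.comp
        (continuous_subtype_val.comp (cm'.comp (((Pull.baseChange X.fInv ψ).continuous.comp
        continuous_fst).prodMk continuous_snd))))) _
    · exact (cρ.comp ((ψ.continuous.comp continuous_fst).prodMk continuous_snd)).mul
        continuous_const
  exact ⟨h.map R, e2, e1⟩

end Retract

end TwistedCW

end HigherTwist

/-! ### Mayer-Vietoris comparison and conclusion -/

namespace HigherTwist

open Set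

namespace TwistedCW

variable {G : Type*} [Group G] [TopologicalSpace G] {E B : Type*}
  [TopologicalSpace E] [TopologicalSpace B] [MulAction Gᵐᵒᵖ E]
  {G₂ : Type*} [Group G₂] [TopologicalSpace G₂] {κ : G × G →* G₂} {p : PrincipalBundle G E B}

section MayerVietoris

variable [ContinuousMul G₂] {h h' : TwistedCW κ p ⥤ GradedObject ℤ AddCommGrpCat.{w}}

theorem isIso_app_iff (η : h ⟶ h') (X : TwistedCW κ p) :
    IsIso (η.app X) ↔ ∀ k, Function.Bijective (η.app X k).hom :=
  ⟨fun _ k => ConcreteCategory.bijective_of_isIso (C := AddCommGrpCat.{w}) (η.app X k), fun hX =>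
    have : ∀ k, IsIso (η.app X k) := fun k =>
      (ConcreteCategory.isIso_iff_bijective (C := AddCommGrpCat.{w}) _).mpr (hX k)
    GradedObject.isIso_of_isIso_apply _⟩

theorem app_ind (η : h ⟶ h') {X Y : TwistedCW κ p} (F : X ⟶ Y) (k : ℤ) (x : h.obj X k) :
    (η.app Y k).hom (ind h F k x) = ind h' F k ((η.app X k).hom x) :=
  congrArg (fun f : h.obj X ⟶ h'.obj Y => (f k).hom x) (η.naturality F)

/-- The five lemma for the two Mayer-Vietoris sequences, with `h_k(X)` in the middle. -/
theorem isIso_app_of_union {mv : MayerVietoris h} {mv' : MayerVietoris h'} {η : h ⟶ h'}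
    (hη : Compatible mv mv' η) {X : TwistedCW κ p} {A A' : CWComplex.Subcomplex X.carrier}
    (hX : (A : Set X.ambient) ∪ A' = X.carrier) (hA : IsIso (η.app (X.restrict A)))
    (hA' : IsIso (η.app (X.restrict A'))) (hi : IsIso (η.app (X.restrict (X.inter A A')))) :
    IsIso (η.app X) := by
  rw [isIso_app_iff] at hA hA' hi ⊢
  intro k
  have hs : ∀ k, (toSum h' X A A' k).comp (η.app (X.restrict (X.inter A A')) k).hom =
      ((η.app (X.restrict A) k).hom.prodMap (η.app (X.restrict A') k).hom).comp
        (toSum h X A A' k) := fun k => AddMonoidHom.ext fun x =>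
    Prod.ext (app_ind η _ k x).symm (app_ind η _ k x).symm
  refine AddMonoidHom.bijective_of_surjective_of_bijective_of_bijective_of_injective
    (toSum h X A A' k) (fromSum h X A A' k) (mv.bd X A A' hX k) (toSum h X A A' (k - 1))
    (toSum h' X A A' k) (fromSum h' X A A' k) (mv'.bd X A A' hX k) (toSum h' X A A' (k - 1))
    (η.app (X.restrict (X.inter A A')) k).hom
    ((η.app (X.restrict A) k).hom.prodMap (η.app (X.restrict A') k).hom) _
    (η.app (X.restrict (X.inter A A')) (k - 1)).hom
    ((η.app (X.restrict A) (k - 1)).hom.prodMap (η.app (X.restrict A') (k - 1)).hom)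
    (hs k) (AddMonoidHom.ext fun x => ?_) (AddMonoidHom.ext fun x => hη X A A' hX k x) (hs (k - 1))
    (mv.exact_sum X A A' hX k) (mv.exact_total X A A' hX k) (mv.exact_inter X A A' hX k)
    (mv'.exact_sum X A A' hX k) (mv'.exact_total X A A' hX k) (mv'.exact_inter X A A' hX k)
    (hi k).2 ((hA k).prodMap (hA' k)) (hi (k - 1)) ((hA (k - 1)).prodMap (hA' (k - 1))).1
  change ind h' _ k _ + -ind h' _ k _ = (η.app X k).hom (ind h _ k x.1 + -ind h _ k x.2)
  rw [map_add, map_neg, app_ind, app_ind]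
  rfl

end MayerVietoris

variable [IsTopologicalGroup G₂] {h h' : TwistedCW κ p ⥤ GradedObject ℤ AddCommGrpCat.{w}}
  {Y : Type} [TopologicalSpace Y] [T2Space Y]

/-- Both functors turn the morphism from the pullback into an isomorphism, so naturality transfers
the claim. The CW structure built from `D` is unrelated to that of `X`; a constant homotopy thus
exchanges one CW structure for another. -/
theorem exists_pullback (hh : HomotopyInvariant h) (hh' : HomotopyInvariant h') (η : h ⟶ h')
    (D : CellStructure Y) {A : Set Y} {H : Y × unitInterval → Y} (hDA : D.carrier ⊆ A)
    (hc : ContinuousOn H (A ×ˢ univ)) (h0 : ∀ y ∈ A, H (y, 0) = y)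
    (h1 : ∀ y ∈ A, H (y, 1) ∈ D.carrier) (hA : ∀ y ∈ A, ∀ t, H (y, t) ∈ A)
    (hD : ∀ y ∈ D.carrier, ∀ t, H (y, t) ∈ D.carrier) {X : TwistedCW κ p} (e : X.carrier ≃ₜ A) :
    letI := D.toCWComplex
    haveI := D.finite_toCWComplex
    ∃ ψ : C(D.carrier, X.carrier),
      IsIso (η.app (X.pullback D.carrier ψ)) → IsIso (η.app X) := by
  let := D.toCWComplex
  have := D.finite_toCWComplex
  have hcA : Continuous fun q : X.carrier × unitInterval => H ((e q.1 : Y), q.2) :=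
    hc.comp_continuous (by fun_prop) fun q => ⟨(e q.1).2, mem_univ _⟩
  have hcD : Continuous fun q : D.carrier × unitInterval => H ((q.1 : Y), q.2) :=
    hc.comp_continuous (by fun_prop) fun q => ⟨hDA q.1.2, mem_univ _⟩
  let ψ : C(D.carrier, X.carrier) :=
    ⟨fun y => e.symm (inclusion hDA y), e.symm.continuous.comp (continuous_inclusion hDA)⟩
  let H' : C(X.carrier × unitInterval, X.carrier) :=
    ⟨fun q => e.symm ⟨H (e q.1, q.2), hA _ (e q.1).2 _⟩, e.symm.continuous.comp (hcA.subtype_mk _)⟩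
  let K : C(D.carrier × unitInterval, D.carrier) :=
    ⟨fun q => ⟨H (q.1, q.2), hD _ q.1.2 _⟩, hcD.subtype_mk _⟩
  let r : C(X.carrier, D.carrier) := ⟨fun x => ⟨H (e x, 1), h1 _ (e x).2⟩,
    (hcA.comp (Continuous.prodMk_left 1)).subtype_mk _⟩
  have hi : ∀ {h : TwistedCW κ p ⥤ GradedObject ℤ AddCommGrpCat.{w}}, HomotopyInvariant h →
      IsIso (h.map (X.pullbackHom D.carrier ψ)) := fun hh =>
    X.isIso_map_pullbackHom D.carrier ψ hh H' r K
      (fun x => (congrArg e.symm (Subtype.ext (h0 _ (e x).2))).trans (e.symm_apply_apply x))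
      (fun x => rfl) (fun y => Subtype.ext (h0 _ (hDA y.2)))
      (fun y => Subtype.ext (by
        change H (y, 1) = H (e (e.symm (inclusion hDA y)), 1)
        rw [e.apply_symm_apply]))
      (fun y t => congrArg e.symm (Subtype.ext (by
        change H (y, t) = H (e (e.symm (inclusion hDA y)), t)
        rw [e.apply_symm_apply])))
  refine ⟨ψ, fun hψ => ?_⟩
  have := hi hh
  have := hi hh'
  have hc : IsIso (h.map (X.pullbackHom D.carrier ψ) ≫ η.app X) := by
    rw [η.naturality]
    infer_instance
  exact IsIso.of_isIso_comp_left (h.map (X.pullbackHom D.carrier ψ)) _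

/-- A natural transformation of homotopy invariant functors with Mayer-Vietoris sequences that is
an isomorphism on points and on the empty space is an isomorphism on finite cell structures. -/
theorem cellInductive (hh : HomotopyInvariant h) (hh' : HomotopyInvariant h')
    {mv : MayerVietoris h} {mv' : MayerVietoris h'} {η : h ⟶ h'} (hη : Compatible mv mv' η)
    (hpt : ∀ X : TwistedCW κ p, Nonempty (Unique X.carrier) → IsIso (η.app X))
    (hempty : ∀ X : TwistedCW κ p, IsEmpty X.carrier → IsIso (η.app X)) :
    CellInductive fun C : Set Y =>
      ∀ X : TwistedCW κ p, Nonempty (X.carrier ≃ₜ C) → IsIso (η.app X) where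
  empty := fun X ⟨e⟩ => hempty X e.toEquiv.isEmpty
  singleton _ := fun X ⟨e⟩ => hpt X ⟨e.toEquiv.unique⟩
  retract D A H hP hDA hc h0 h1 hA hD := fun X ⟨e⟩ => by
    obtain ⟨ψ, hψ⟩ := exists_pullback hh hh' η D hDA hc h0 h1 hA hD e
    exact hψ (hP _ ⟨Homeomorph.refl _⟩)
  union D K L hK hL hDK hDL hKL hPK hPL hPI := fun X ⟨e⟩ => by
    -- The constant homotopy: only the CW structure changes, to one in which `K` and `L` are
    -- subcomplexes.
    obtain ⟨ψ, hψ⟩ := exists_pullback hh hh' η D (H := Prod.fst) subset_rfl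
      continuous_fst.continuousOn (fun _ _ => rfl) (fun _ h => h) (fun _ h _ => h)
      (fun _ h _ => h) e
    obtain ⟨A, rfl⟩ := D.exists_subcomplex hDK hK
    obtain ⟨A', rfl⟩ := D.exists_subcomplex hDL hL
    let := D.toCWComplex
    have := D.finite_toCWComplex
    exact hψ (isIso_app_of_union (X := X.pullback D.carrier ψ) hη (A := A) (A' := A') hKL
      (hPK _ ⟨Homeomorph.refl _⟩) (hPL _ ⟨Homeomorph.refl _⟩) (hPI _ ⟨Homeomorph.refl _⟩))

end TwistedCW

end HigherTwist

theorem mainTheorem12 {D : Type u} [CStarAlgebra D]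
    (hD : HigherTwist.IsStronglySelfAbsorbing D)
    {E : Type*} {B : Type*} [TopologicalSpace E] [TopologicalSpace B]
    [MulAction (HigherTwist.AutStab D)ᵐᵒᵖ E]
    (p : HigherTwist.PrincipalBundle (HigherTwist.AutStab D) E B) (hp : p.IsUniversal)
    (h h' : CategoryTheory.Functor (HigherTwist.CWD D p)
      (CategoryTheory.GradedObject ℤ AddCommGrpCat.{w}))
    (hh : HigherTwist.TwistedCW.HomotopyInvariant h)
    (hh' : HigherTwist.TwistedCW.HomotopyInvariant h')
    (mv : HigherTwist.TwistedCW.MayerVietoris h)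
    (mv' : HigherTwist.TwistedCW.MayerVietoris h')
    (η : h ⟶ h') (hη : HigherTwist.TwistedCW.Compatible mv mv' η)
    (hpt : ∀ X : HigherTwist.CWD D p, Nonempty (Unique X.carrier) →
      CategoryTheory.IsIso (η.app X))
    (hempty : ∀ X : HigherTwist.CWD D p, IsEmpty X.carrier → CategoryTheory.IsIso (η.app X))
    (X : HigherTwist.CWD D p) :
    CategoryTheory.IsIso (η.app X) := by
  -- The induction takes place among the subsets of the ambient space of `X`.
  refine (HigherTwist.TwistedCW.cellInductive hh hh' hη hpt hempty).carrier
    (HigherTwist.CellStructure.ofCWComplex X.carrier) X ?_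
  rw [HigherTwist.CellStructure.carrier_ofCWComplex]
  exact ⟨Homeomorph.refl _⟩
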